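/- Let $n\ge 2$, let $F_q$ be a finite field of characteristic $p$, and let $G=\mathrm{GL}_n(q)$, with $B$ its upper triangular subgroup, $U$ its upper unitriangular subgroup, and $S_n\subseteq G$ embedded as permutation matrices. Let $\ell\neq p$ be a prime and let $R$ be a local principal ideal domain of characteristic $0$ with maximal ideal $\ell R$, containing a primitive $p$-th root of unity; put $K=R/\ell R$. Let $$e=\sum_{\sigma\in S_n}\mathrm{sg}(\sigma)\,\sigma\sum_{b\in B}b\in RG,\qquad I=RG\cdot e,\qquad L=I/\ell I,$$ so that $I$ is the Steinberg lattice and $L$ is a $KG$-module. A standard parabolic subgroup is a subgroup of $G$ containing $B$. For a composition $(a_1,\dots,a_k)$ of $n$ let $P_{(a_1,\dots,a_k)}$ be the block upper triangular group with diagonal blocks of sizes $a_1,\dots,a_k$; every standard parabolic subgroup is of this form for a unique composition. Two standard parabolic subgroups are equivalent if their compositions are rearrangements of each other. For a group homomorphism $\lambda:U\to R^*$ let $J(\lambda)$ be the set of transpositions $(i,i+1)$, $1\le i<n$, such that $\lambda$ is non-trivial on the root subgroup $X_{i,i+1}=\{1+aE^{i,i+1}: a\in F_q\}$; put $P(\lambda)=\langle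 B,J(\lambda)\rangle$, $E_\lambda=\sum_{u\in U}\lambda(u)\,u e\in I$ and $F_\lambda=E_\lambda+\ell I\in L$. For a standard parabolic subgroup $P$ put $$I'(P)=RG\cdot E_\lambda,\qquad L'(P)=(I'(P)+\ell I)/\ell I=KG\cdot F_\lambda$$ for any $\lambda$ with $P(\lambda)=P$. Such $\lambda$ exist, and these submodules do not depend on the choice of $\lambda$. Theorem. Let $P$ and $Q$ be standard parabolic subgroups of $G$. If $Q$ is equivalent to a standard parabolic subgroup contained in $P$, then $I'(Q)\subseteq I'(P)$, and consequently $L'(Q)\subseteq L'(P)$. In particular, if $P$ and $Q$ are equivalent, then $I'(P)=I'(Q)$. -/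

import Mathlib

open scoped MonoidAlgebra

namespace Steinberg

/-! ### Subgroups of the general linear group -/

section Groups

variable {n : ℕ} {F : Type*} [Field F]

lemma blockTriangular_inv {α : Type*} [LinearOrder α] {b : Fin n → α} {g : GL (Fin n) F}
    (hg : (g : Matrix (Fin n) (Fin n) F).BlockTriangular b) :
    ((g⁻¹ : GL (Fin n) F) : Matrix (Fin n) (Fin n) F).BlockTriangular b := by
  rw [Matrix.coe_units_inv]
  have : Invertible (g : Matrix (Fin n) (Fin n) F) := g.invertible
  exact Matrix.blockTriangular_inv_of_blockTriangular hg

lemma upper_mul_diag {M N : Matrix (Fin n) (Fin n) F}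
    (hM : M.BlockTriangular id) (hN : N.BlockTriangular id) (i : Fin n) :
    (M * N) i i = M i i * N i i := by
  rw [Matrix.mul_apply]
  refine Finset.sum_eq_single i (fun j _ hj => ?_) (by simp)
  rcases lt_or_gt_of_ne hj with h | h
  · rw [hM (show id j < id i from h), zero_mul]
  · rw [hN (show id i < id j from h), mul_zero]

/-- The group of invertible matrices that are block upper triangular
with respect to the labelling `b` of the rows and columns. -/
def blockUpper {α : Type*} [LinearOrder α] (F : Type*) [Field F] (b : Fin n → α) :
    Subgroup (GL (Fin n) F) where
  carrier := {g | (g : Matrix (Fin n) (Fin n) F).BlockTriangular b}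
  one_mem' := Matrix.blockTriangular_one
  mul_mem' := fun hg hh => by
    change Matrix.BlockTriangular ((_ * _ : GL (Fin n) F) : Matrix (Fin n) (Fin n) F) b
    rw [Units.val_mul]
    exact Matrix.BlockTriangular.mul hg hh
  inv_mem' := fun hg => blockTriangular_inv hg

/-- The upper triangular subgroup `B` of `GL_n(F)`. -/
def borel (n : ℕ) (F : Type*) [Field F] : Subgroup (GL (Fin n) F) :=
  blockUpper F (id : Fin n → Fin n)

/-- The upper unitriangular subgroup `U` of `GL_n(F)`. -/
def unitri (n : ℕ) (F : Type*) [Field F] : Subgroup (GL (Fin n) F) where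
  carrier := {g | g ∈ borel n F ∧ ∀ i, (g : Matrix (Fin n) (Fin n) F) i i = 1}
  one_mem' := ⟨one_mem _, fun i => by simp⟩
  mul_mem' := fun {g h} hg hh => ⟨mul_mem hg.1 hh.1, fun i => by
    rw [Units.val_mul, upper_mul_diag hg.1 hh.1, hg.2, hh.2, one_mul]⟩
  inv_mem' := fun {g} hg => ⟨inv_mem hg.1, fun i => by
    have h := upper_mul_diag hg.1 (blockTriangular_inv hg.1) i
    rw [← Units.val_mul, mul_inv_cancel, hg.2, one_mul] at h
    simpa using h.symm⟩

/-- The permutation matrix of `σ`, which sends the basis column `e_j` to `e_{σ j}`. -/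
noncomputable def permGL (n : ℕ) (F : Type*) [Field F] :
    Equiv.Perm (Fin n) →* GL (Fin n) F :=
  (Matrix.permMatrixHom : Equiv.Perm (Fin n) →* Matrix (Fin n) (Fin n) F).toHomUnits

/-- The elementary matrix `t_{ij}(a) = 1 + a E^{ij}`, `i < j`, as an element of `U`. -/
def rootElt {i j : Fin n} (h : i < j) (a : F) : unitri n F :=
  ⟨⟨Matrix.transvection i j a, Matrix.transvection i j (-a),
      by rw [Matrix.transvection_mul_transvection_same i j h.ne, add_neg_cancel,
        Matrix.transvection_zero],
      by rw [Matrix.transvection_mul_transvection_same i j h.ne, neg_add_cancel,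
        Matrix.transvection_zero]⟩,
    Matrix.blockTriangular_transvection h.le a, fun k => by
      have hk : ¬ (i = k ∧ j = k) := fun hk => h.ne (hk.1.trans hk.2.symm)
      simp [Matrix.transvection, hk]⟩

/-- A standard parabolic subgroup is a subgroup of `GL_n(F)` that contains `B`. -/
def IsStandardParabolic (P : Subgroup (GL (Fin n) F)) : Prop := borel n F ≤ P

/-- `P_J = ⟨B, J⟩` for a set `J` of permutations. -/
noncomputable def parabolicOf (F : Type*) [Field F] (J : Set (Equiv.Perm (Fin n))) :
    Subgroup (GL (Fin n) F) :=
  borel n F ⊔ Subgroup.closure (permGL n F '' J)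

/-- `P_{(a_1,...,a_k)}`: the block upper triangular group whose diagonal blocks have the
sizes `a_1, ..., a_k`. -/
def compParabolic (F : Type*) [Field F] (c : Composition n) : Subgroup (GL (Fin n) F) :=
  blockUpper F c.index

/-- Two parabolic subgroups are equivalent if the corresponding compositions of `n` are
rearrangements of each other. -/
def ParabolicEquiv (P Q : Subgroup (GL (Fin n) F)) : Prop :=
  ∃ a b : Composition n, P = compParabolic F a ∧ Q = compParabolic F b ∧
    List.Perm a.blocks b.blocks

end Groups

/-! ### Characters of the unitriangular group -/

section Characters

variable {n : ℕ} {F : Type*} [Field F] {R : Type*} [CommRing R]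

/-- `J(lam)`: the fundamental transpositions `(i, i+1)` such that `lam` is nontrivial on the
root subgroup `X_{i,i+1}`. -/
def charSupport (lam : unitri n F →* Rˣ) : Set (Equiv.Perm (Fin n)) :=
  {s | ∃ (i j : Fin n) (h : i < j), i.val + 1 = j.val ∧ s = Equiv.swap i j ∧
    ∃ a : F, lam (rootElt h a) ≠ 1}

/-- `P(lam) = P_{J(lam)}`. -/
noncomputable def charParabolic (lam : unitri n F →* Rˣ) : Subgroup (GL (Fin n) F) :=
  parabolicOf F (charSupport lam)

end Characters

/-! ### Reduction of the group algebra modulo `ℓ` -/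

section Reduction

variable (n : ℕ) (F : Type*) [Field F] (R : Type*) [CommRing R] (ℓ : ℕ)

/-- The residue ring `K = R / ℓ R`. -/
abbrev Residue : Type _ := R ⧸ Ideal.span {(ℓ : R)}

/-- The coefficientwise reduction `RG → KG`. -/
noncomputable def redHom : R[GL (Fin n) F] →+* (Residue R ℓ)[GL (Fin n) F] :=
  MonoidAlgebra.mapRingHom (GL (Fin n) F) (Ideal.Quotient.mk (Ideal.span {(ℓ : R)}))

lemma redHom_surjective : Function.Surjective (redHom n F R ℓ) :=
  MonoidAlgebra.map_surjective (Ideal.Quotient.mk (Ideal.span {(ℓ : R)})).toAddMonoidHom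
    Ideal.Quotient.mk_surjective

end Reduction

/-! ### The Steinberg lattice and its reduction -/

section Lattice

variable (n : ℕ) (F : Type*) [Field F] [Fintype F] (R : Type*) [CommRing R] (ℓ : ℕ)

open Classical in
/-- The element `∑_{σ ∈ S_n} sg(σ) σ ∑_{b ∈ B} b` of the group algebra `RG`. -/
noncomputable def steinbergElt : R[GL (Fin n) F] :=
  ∑ σ : Equiv.Perm (Fin n), ((Equiv.Perm.sign σ : ℤ) : R) •
    (MonoidAlgebra.of R (GL (Fin n) F) (permGL n F σ) *
      ∑ b : borel n F, MonoidAlgebra.of R (GL (Fin n) F) (b : GL (Fin n) F))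

/-- The Steinberg lattice `I`: the left ideal of `RG` generated by `steinbergElt`. -/
noncomputable def lattice : Submodule R[GL (Fin n) F] R[GL (Fin n) F] :=
  Submodule.span R[GL (Fin n) F] {steinbergElt n F R}

/-- `steinbergElt` as an element of `I`. -/
noncomputable def latticeGen : lattice n F R :=
  ⟨steinbergElt n F R, Submodule.subset_span rfl⟩

/-- `ℓ I`. -/
noncomputable def ellLattice : Submodule R[GL (Fin n) F] (lattice n F R) :=
  LinearMap.range (ℓ • (LinearMap.id : lattice n F R →ₗ[R[GL (Fin n) F]] lattice n F R))

/-- `L = I / ℓ I`. -/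
abbrev Reduction : Type _ := lattice n F R ⧸ ellLattice n F R ℓ

variable {n F R ℓ}

lemma ell_smul_reduction (m : Reduction n F R ℓ) : ℓ • m = 0 := by
  obtain ⟨x, rfl⟩ := Submodule.Quotient.mk_surjective _ m
  rw [← Submodule.Quotient.mk_smul, Submodule.Quotient.mk_eq_zero]
  exact ⟨x, by simp⟩

lemma smul_eq_zero_of_redHom (x : R[GL (Fin n) F]) (hx : redHom n F R ℓ x = 0)
    (m : Reduction n F R ℓ) : x • m = 0 := by
  have key : ∀ g : GL (Fin n) F, MonoidAlgebra.single g (x.coeff g) • m = 0 := by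
    intro g
    have h : Ideal.Quotient.mk (Ideal.span {(ℓ : R)}) (x.coeff g) = 0 := by
      rw [← MonoidAlgebra.coeff_mapRingHom]
      change (redHom n F R ℓ x).coeff g = 0
      rw [hx]; rfl
    rw [Ideal.Quotient.eq_zero_iff_mem, Ideal.mem_span_singleton] at h
    obtain ⟨r, hr⟩ := h
    have : MonoidAlgebra.single g (x.coeff g) = ℓ • MonoidAlgebra.single g r := by
      rw [hr, MonoidAlgebra.smul_single, nsmul_eq_mul]
    rw [this, smul_assoc, ell_smul_reduction]
  have hs : x = ∑ g ∈ x.coeff.support, MonoidAlgebra.single g (x.coeff g) := by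
    apply MonoidAlgebra.coeff_injective
    rw [MonoidAlgebra.coeff_sum]
    exact (Finsupp.sum_single x.coeff).symm
  rw [hs, Finset.sum_smul]
  exact Finset.sum_eq_zero fun g _ => key g

noncomputable instance instSMulReduction : SMul (Residue R ℓ)[GL (Fin n) F] (Reduction n F R ℓ) where
  smul y m := Function.surjInv (redHom_surjective n F R ℓ) y • m

lemma redHom_smul (x : R[GL (Fin n) F]) (m : Reduction n F R ℓ) :
    redHom n F R ℓ x • m = x • m := by
  change Function.surjInv (redHom_surjective n F R ℓ) (redHom n F R ℓ x) • m = x • m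
  rw [← sub_eq_zero, ← sub_smul]
  apply smul_eq_zero_of_redHom
  rw [map_sub, Function.surjInv_eq (redHom_surjective n F R ℓ), sub_self]

/-- The `KG`-module structure of `L`, determined by `redHom_smul`. -/
noncomputable instance instModuleReduction : Module (Residue R ℓ)[GL (Fin n) F] (Reduction n F R ℓ) :=
  Function.Surjective.moduleLeft (redHom n F R ℓ) (redHom_surjective n F R ℓ) redHom_smul

open Classical in
/-- `E_lam = ∑_{u ∈ U} lam(u) u e`, where `e` is `steinbergElt`. -/
noncomputable def charElt (lam : unitri n F →* Rˣ) : lattice n F R :=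
  ∑ u : unitri n F, MonoidAlgebra.single (u : GL (Fin n) F) ((lam u : Rˣ) : R) • latticeGen n F R

variable (R ℓ)

/-- `I'(P)`: the `RG`-submodule of `I` generated by the elements `E_lam` with `P(lam) = P`
(each of them generates it). -/
noncomputable def IPrime (P : Subgroup (GL (Fin n) F)) :
    Submodule R[GL (Fin n) F] (lattice n F R) :=
  Submodule.span R[GL (Fin n) F]
    {x | ∃ lam : unitri n F →* Rˣ, charParabolic lam = P ∧ x = charElt lam}

/-- `L'(P) = (I'(P) + ℓ I) / ℓ I`, a `KG`-submodule of `L`. -/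
noncomputable def LPrime (P : Subgroup (GL (Fin n) F)) :
    Submodule (Residue R ℓ)[GL (Fin n) F] (Reduction n F R ℓ) where
  carrier := (IPrime R P).map (ellLattice n F R ℓ).mkQ
  add_mem' := fun ha hb => add_mem (S := Submodule R[GL (Fin n) F] (Reduction n F R ℓ)) ha hb
  zero_mem' := zero_mem ((IPrime R P).map (ellLattice n F R ℓ).mkQ)
  smul_mem' := fun y m hm => by
    obtain ⟨x, rfl⟩ := redHom_surjective n F R ℓ y
    rw [redHom_smul]
    exact Submodule.smul_mem ((IPrime R P).map (ellLattice n F R ℓ).mkQ) x hm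

end Lattice

end Steinberg

namespace Steinberg

/-! ### Permutation matrices, root elements and block triangular groups -/

section Entries

variable {n : ℕ} {F : Type*} [Field F]

/-! Write A_λ = ∑ λ(u) u, so that E_λ = A_λ e. The rank one relation s x(t) e = x(t⁻¹) e - e makes
the R-span of U·e stable under permutation matrices (`permGL_mul_mem_unitriSpan`), and A_μ sends
that span into R·E_μ because A_μ u = μ(u)⁻¹ A_μ. Hence for every permutation w there is a scalar c
with A_μ w E_λ = c E_μ, and E_μ ∈ RG·E_λ as soon as c is a unit.

The scalar is found by comparing coefficients at elements h of a block triangular group P_b. A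
unipotent x outside P_b contributes nothing there (`coeff_steinbergElt_eq_zero`). If every u ∈ U
with w u w⁻¹ ∈ P_b satisfies w u w⁻¹ ∈ U and λ(u) = μ(w u w⁻¹), the remaining terms give c =
sg(w)·#{u ∈ U : w u w⁻¹ ∈ P_b}, provided that E_μ has a nonzero coefficient somewhere on P_b
(`exists_coeff_charElt_ne_zero`). The count is the order of a subgroup of the p-group U, hence a
power of p, and p is a unit of R since ℓ ≠ p. This is `charElt_mem_span_of_conj`.

Two choices of w yield the theorem. A w that rearranges blocks and keeps the order inside each block
handles equivalent parabolics. A w that reverses the sequence of blocks puts no condition on λ at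
the simple roots between blocks, so λ may have larger support; this gives the inclusion for Q ≤ P
with the support of λ reversed, and a second use of the same step undoes the reversal
(`charElt_stdChar_mem_span_of_le`).

It remains to reduce arbitrary characters to standard ones. Characters of U are determined on simple
root subgroups, every additive character of F is a shift of a fixed nontrivial ψ, and diagonal
matrices fix e while permuting the characters with given support (`exists_torusConj_eq`). That every
overgroup of B is some P(λ) follows from the Bruhat decomposition (`parabolicOf_eq`). -/

lemma permGL_apply (σ : Equiv.Perm (Fin n)) (i j : Fin n) :
    (permGL n F σ : Matrix (Fin n) (Fin n) F) i j = if i = σ j then 1 else 0 := by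
  change (σ⁻¹).permMatrix F i j = _
  simp [PEquiv.toMatrix_apply, Equiv.Perm.inv_def, Equiv.symm_apply_eq]

lemma permGL_mul_apply (σ : Equiv.Perm (Fin n)) (g : GL (Fin n) F) (i j : Fin n) :
    ((permGL n F σ * g : GL (Fin n) F) : Matrix (Fin n) (Fin n) F) i j = g (σ⁻¹ i) j := by
  rw [Units.val_mul, Matrix.mul_apply, Finset.sum_eq_single (σ⁻¹ i)]
  · simp [permGL_apply]
  · intro k _ hk
    rw [permGL_apply, if_neg, zero_mul]
    rintro rfl
    simp at hk
  · simp

lemma mul_permGL_apply (g : GL (Fin n) F) (σ : Equiv.Perm (Fin n)) (i j : Fin n) :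
    ((g * permGL n F σ : GL (Fin n) F) : Matrix (Fin n) (Fin n) F) i j = g i (σ j) := by
  rw [Units.val_mul, Matrix.mul_apply, Finset.sum_eq_single (σ j)]
  · simp [permGL_apply]
  · intro k _ hk
    rw [permGL_apply, if_neg hk, mul_zero]
  · simp

lemma conj_permGL_apply (σ : Equiv.Perm (Fin n)) (g : GL (Fin n) F) (i j : Fin n) :
    ((permGL n F σ * g * (permGL n F σ)⁻¹ : GL (Fin n) F) : Matrix (Fin n) (Fin n) F) i j =
      g (σ⁻¹ i) (σ⁻¹ j) := by
  rw [← map_inv, mul_permGL_apply, permGL_mul_apply]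

lemma conj_permGL_apply' (σ : Equiv.Perm (Fin n)) (g : GL (Fin n) F) (i j : Fin n) :
    (((permGL n F σ)⁻¹ * g * permGL n F σ : GL (Fin n) F) : Matrix (Fin n) (Fin n) F) i j =
      g (σ i) (σ j) := by
  rw [← map_inv, mul_permGL_apply, permGL_mul_apply, inv_inv]

lemma mem_blockUpper {α : Type*} [LinearOrder α] {b : Fin n → α} {g : GL (Fin n) F} :
    g ∈ blockUpper F b ↔ ∀ i j, (g : Matrix (Fin n) (Fin n) F) i j ≠ 0 → b i ≤ b j := by
  refine ⟨fun h i j hij => ?_, fun h i j hij => ?_⟩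
  · by_contra hlt
    exact hij (h (not_le.1 hlt))
  · by_contra hne
    exact absurd (h i j hne) (not_le.2 hij)

lemma mem_borel {g : GL (Fin n) F} :
    g ∈ borel n F ↔ ∀ i j, (g : Matrix (Fin n) (Fin n) F) i j ≠ 0 → i ≤ j :=
  mem_blockUpper

lemma borel_diag_ne_zero {g : GL (Fin n) F} (hg : g ∈ borel n F) (i : Fin n) :
    (g : Matrix (Fin n) (Fin n) F) i i ≠ 0 := by
  have h := upper_mul_diag hg (blockTriangular_inv hg) i
  rw [← Units.val_mul, mul_inv_cancel, Units.val_one, Matrix.one_apply_eq] at h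
  intro h0
  rw [h0, zero_mul] at h
  exact one_ne_zero h

lemma rootElt_coe {i j : Fin n} (h : i < j) (a : F) :
    ((rootElt h a : GL (Fin n) F) : Matrix (Fin n) (Fin n) F) = Matrix.transvection i j a := rfl

lemma transvection_apply (i j : Fin n) (a : F) (k l : Fin n) :
    Matrix.transvection i j a k l = (if k = l then 1 else 0) + if i = k ∧ j = l then a else 0 := by
  simp [Matrix.transvection, Matrix.one_apply, Matrix.single_apply]

lemma rootElt_mem_borel {i j : Fin n} (h : i < j) (a : F) :
    (rootElt h a : GL (Fin n) F) ∈ borel n F :=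
  (rootElt h a).2.1

lemma rootElt_add {i j : Fin n} (h : i < j) (a b : F) :
    rootElt h (a + b) = rootElt h a * rootElt h b := by
  ext1; ext1
  simp only [Subgroup.coe_mul, Units.val_mul, rootElt_coe]
  rw [Matrix.transvection_mul_transvection_same i j h.ne]

lemma rootElt_zero {i j : Fin n} (h : i < j) : rootElt h (0 : F) = 1 := by
  ext1; ext1
  simp [rootElt_coe]

lemma rootElt_neg {i j : Fin n} (h : i < j) (a : F) : rootElt h (-a) = (rootElt h a)⁻¹ := by
  rw [eq_inv_iff_mul_eq_one, ← rootElt_add, neg_add_cancel, rootElt_zero]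

/-- A conjugate of a root subgroup by a permutation matrix stays upper triangular when the
permutation keeps the two indices in order. -/
lemma conj_mem_borel {i j : Fin n} {g : GL (Fin n) F} {σ : Equiv.Perm (Fin n)}
    (hσ : σ⁻¹ i < σ⁻¹ j)
    (hg : ∀ a b, (g : Matrix (Fin n) (Fin n) F) a b ≠ 0 → a = b ∨ (a = i ∧ b = j)) :
    (permGL n F σ)⁻¹ * g * permGL n F σ ∈ borel n F := by
  rw [mem_borel]
  intro a b hab
  rw [conj_permGL_apply'] at hab
  rcases hg _ _ hab with h | ⟨h1, h2⟩
  · exact (σ.injective h).le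
  · rw [← h1, ← h2] at hσ
    simpa using hσ.le

lemma rootElt_support {i j : Fin n} (h : i < j) (t : F) (a b : Fin n)
    (hab : ((rootElt h t : GL (Fin n) F) : Matrix (Fin n) (Fin n) F) a b ≠ 0) :
    a = b ∨ (a = i ∧ b = j) := by
  rw [rootElt_coe, transvection_apply] at hab
  by_contra hne
  push Not at hne
  apply hab
  rw [if_neg hne.1, if_neg, add_zero]
  rintro ⟨rfl, rfl⟩
  exact hne.2 rfl rfl

/-- The correcting factor in `s x(t) s = x(t⁻¹) s b₀`. -/
noncomputable def rankOneFactor {i j : Fin n} (h : i < j) (t : F) : GL (Fin n) F :=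
  permGL n F (Equiv.swap i j) * (rootElt h (-t⁻¹) : GL (Fin n) F) * permGL n F (Equiv.swap i j) *
    (rootElt h t : GL (Fin n) F) * permGL n F (Equiv.swap i j)

lemma permGL_swap_mul_self (i j : Fin n) :
    permGL n F (Equiv.swap i j) * permGL n F (Equiv.swap i j) = 1 := by
  rw [← map_mul, Equiv.swap_mul_self, map_one]

lemma rankOne_relation {i j : Fin n} (h : i < j) (t : F) :
    permGL n F (Equiv.swap i j) * (rootElt h t : GL (Fin n) F) * permGL n F (Equiv.swap i j) =
      (rootElt h t⁻¹ : GL (Fin n) F) * permGL n F (Equiv.swap i j) * rankOneFactor h t := by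
  rw [rankOneFactor, rootElt_neg, Subgroup.coe_inv]
  have hs := permGL_swap_mul_self (F := F) i j
  generalize permGL n F (Equiv.swap i j) = s at *
  generalize (rootElt h t⁻¹ : GL (Fin n) F) = x
  simp only [mul_assoc]
  rw [← mul_assoc s s, hs, one_mul, mul_inv_cancel_left]

/-- A computation inside GL₂ on the coordinates i, j. The bound on the support, sharper than upper
triangularity, lets the factor be conjugated into B by any permutation whose inverse keeps i before
j. -/
lemma rankOneFactor_support {i j : Fin n} (h : i < j) {t : F} (ht : t ≠ 0) (a b : Fin n)
    (hab : (rankOneFactor h t : Matrix (Fin n) (Fin n) F) a b ≠ 0) :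
    a = b ∨ (a = i ∧ b = j) := by
  rw [rankOneFactor, mul_permGL_apply] at hab
  have hinv : permGL n F (Equiv.swap i j) = (permGL n F (Equiv.swap i j))⁻¹ := by
    rw [← map_inv, Equiv.swap_inv]
  have hlow : ((permGL n F (Equiv.swap i j) * (rootElt h (-t⁻¹) : GL (Fin n) F) *
      permGL n F (Equiv.swap i j) : GL (Fin n) F) : Matrix (Fin n) (Fin n) F) =
      Matrix.transvection j i (-t⁻¹) := by
    ext k l
    nth_rewrite 2 [hinv]
    rw [conj_permGL_apply, rootElt_coe, transvection_apply, transvection_apply, Equiv.swap_inv]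
    congr 1
    · simp
    · have h1 : i = Equiv.swap i j k ↔ j = k := by
        rw [eq_comm, Equiv.swap_apply_eq_iff, Equiv.swap_apply_left, eq_comm]
      have h2 : j = Equiv.swap i j l ↔ i = l := by
        rw [eq_comm, Equiv.swap_apply_eq_iff, Equiv.swap_apply_right, eq_comm]
      simp only [h1, h2]
  rw [Units.val_mul, hlow, rootElt_coe] at hab
  by_cases haj : a = j
  · subst haj
    rw [Matrix.transvection_mul_apply_same, transvection_apply, transvection_apply] at hab
    left
    by_contra hb
    apply hab
    by_cases hbi : b = i
    · subst hbi
      simp [h.ne, ht]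
    · have : Equiv.swap i a b = b := Equiv.swap_apply_of_ne_of_ne hbi (Ne.symm hb)
      rw [this]
      simp [h.ne, hb, Ne.symm hbi]
  · rw [Matrix.transvection_mul_apply_of_ne _ _ _ _ haj, transvection_apply] at hab
    by_cases hai : a = i
    · subst hai
      by_cases hb : b = a ∨ b = j
      · rcases hb with rfl | rfl <;> simp
      · push Not at hb
        rw [Equiv.swap_apply_of_ne_of_ne hb.1 hb.2] at hab
        simp [Ne.symm hb.1, Ne.symm hb.2] at hab
    · left
      have h1 : a = Equiv.swap i j b := by
        by_contra hne
        apply hab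
        simp [hne, Ne.symm hai]
      rw [eq_comm, Equiv.swap_apply_eq_iff, Equiv.swap_apply_of_ne_of_ne hai haj] at h1
      exact h1.symm

lemma rankOneFactor_mem_borel {i j : Fin n} (h : i < j) {t : F} (ht : t ≠ 0) :
    rankOneFactor h t ∈ borel n F := by
  rw [mem_borel]
  intro a b hab
  rcases rankOneFactor_support h ht a b hab with rfl | ⟨rfl, rfl⟩
  · exact le_rfl
  · exact h.le

/-- A permutation that does not decrease a label preserves it. -/
lemma label_comp_perm {α : Type*} [Fintype α] {b : α → ℕ} {σ : Equiv.Perm α}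
    (h : ∀ i, b i ≤ b (σ i)) (i : α) : b (σ i) = b i := by
  -- Both labels have the same sum, so a termwise inequality is an equality.
  have := (Finset.sum_eq_sum_iff_of_le (s := Finset.univ) (fun i _ => h i)).1
    (Equiv.sum_comp σ b).symm i (Finset.mem_univ i)
  exact this.symm

/-- The product has the nonzero entry u_ii at (i, σ⁻¹ i), so σ⁻¹ cannot decrease labels and
therefore preserves them. -/
lemma label_of_mul_permGL_mem {b : Fin n → ℕ} {u : GL (Fin n) F}
    (hu : ∀ i, (u : Matrix (Fin n) (Fin n) F) i i ≠ 0) {σ : Equiv.Perm (Fin n)}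
    (h : u * permGL n F σ ∈ blockUpper F b) (i : Fin n) : b (σ i) = b i := by
  have key : ∀ i, b i ≤ b (σ⁻¹ i) := fun i => by
    refine mem_blockUpper.1 h i (σ⁻¹ i) ?_
    rw [mul_permGL_apply]
    simpa using hu i
  simpa using (label_comp_perm key (σ i)).symm

lemma permGL_mem_blockUpper {b : Fin n → ℕ} {σ : Equiv.Perm (Fin n)}
    (h : ∀ i, b (σ i) = b i) : permGL n F σ ∈ blockUpper F b := by
  rw [mem_blockUpper]
  intro i j hij
  rw [permGL_apply] at hij
  have : i = σ j := by
    by_contra hne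
    exact hij (if_neg hne)
  rw [this, h]

lemma borel_le_blockUpper {b : Fin n → ℕ} (hb : Monotone b) : borel n F ≤ blockUpper F b :=
  fun _ hg => mem_blockUpper.2 fun i j hij => hb (mem_borel.1 hg i j hij)

/-- Conjugation by a fundamental reflection preserves the upper triangular matrices whose entry
at the corresponding simple root vanishes. -/
lemma conj_swap_mem_borel {i j : Fin n} (hij : i.val + 1 = j.val) {g : GL (Fin n) F}
    (hg : g ∈ borel n F) (h0 : (g : Matrix (Fin n) (Fin n) F) i j = 0) :
    permGL n F (Equiv.swap i j) * g * permGL n F (Equiv.swap i j) ∈ borel n F := by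
  have hinv : permGL n F (Equiv.swap i j) = (permGL n F (Equiv.swap i j))⁻¹ := by
    rw [← map_inv, Equiv.swap_inv]
  nth_rewrite 2 [hinv]
  rw [mem_borel]
  intro a b hab
  rw [conj_permGL_apply, Equiv.swap_inv] at hab
  have hle := mem_borel.1 hg _ _ hab
  have hne : ¬ (Equiv.swap i j a = i ∧ Equiv.swap i j b = j) := fun h => by
    rw [h.1, h.2] at hab
    exact hab h0
  rw [Equiv.swap_apply_def, Equiv.swap_apply_def] at hle hne
  rw [Fin.le_def] at *
  split_ifs at hle hne <;> simp_all [Fin.ext_iff] <;> omega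

end Entries

/-! ### The Steinberg element in the group algebra -/

lemma coeff_of_mul {G R : Type*} [Group G] [Semiring R] (g h : G) (z : R[G]) :
    (MonoidAlgebra.of R G g * z).coeff h = z.coeff (g⁻¹ * h) := by
  rw [MonoidAlgebra.of_apply, MonoidAlgebra.coeff_single_mul_eq_mul_coeff (g⁻¹ * h)]
  · simp
  · intro m _
    rw [eq_inv_mul_iff_mul_eq]

section GroupAlgebra

variable {n : ℕ} {F : Type*} [Field F] [Fintype F] {R : Type*} [CommRing R]

open MonoidAlgebra (of)

variable (n F R) in
open Classical in
/-- The sum of the elements of `B` in the group algebra. -/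
noncomputable def borelSum : R[GL (Fin n) F] := ∑ b : borel n F, of R (GL (Fin n) F) b

lemma steinbergElt_eq : steinbergElt n F R = ∑ σ : Equiv.Perm (Fin n),
    ((Equiv.Perm.sign σ : ℤ) : R) • (of R (GL (Fin n) F) (permGL n F σ) * borelSum n F R) := rfl

lemma of_mul_borelSum {b : GL (Fin n) F} (hb : b ∈ borel n F) :
    of R (GL (Fin n) F) b * borelSum n F R = borelSum n F R := by
  classical
  rw [borelSum, Finset.mul_sum]
  refine Fintype.sum_equiv (Equiv.mulLeft (⟨b, hb⟩ : borel n F)) _ _ fun x => ?_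
  rw [← map_mul]
  rfl

lemma of_mul_borelSum_congr {g h : GL (Fin n) F} (hgh : h⁻¹ * g ∈ borel n F) :
    of R (GL (Fin n) F) g * borelSum n F R = of R (GL (Fin n) F) h * borelSum n F R := by
  conv_rhs => rw [← of_mul_borelSum hgh, ← mul_assoc, ← map_mul, mul_inv_cancel_left]

lemma permGL_mul_steinbergElt (w : Equiv.Perm (Fin n)) :
    of R (GL (Fin n) F) (permGL n F w) * steinbergElt n F R =
      ((Equiv.Perm.sign w : ℤ) : R) • steinbergElt n F R := by
  rw [steinbergElt_eq, Finset.mul_sum, Finset.smul_sum]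
  refine Fintype.sum_equiv (Equiv.mulLeft w) _ _ fun σ => ?_
  rw [Equiv.coe_mulLeft, map_mul, map_mul, mul_smul_comm, smul_smul, ← mul_assoc, map_mul]
  congr 1
  push_cast
  rw [← mul_assoc, ← Int.cast_mul, ← Units.val_mul, Int.units_mul_self]
  simp

/-- Diagonal matrices fix the Steinberg element. -/
lemma diagonal_mul_steinbergElt {h : GL (Fin n) F}
    (hh : ∀ a b, (h : Matrix (Fin n) (Fin n) F) a b ≠ 0 → a = b) :
    of R (GL (Fin n) F) h * steinbergElt n F R = steinbergElt n F R := by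
  rw [steinbergElt_eq, Finset.mul_sum]
  refine Finset.sum_congr rfl fun σ _ => ?_
  rw [mul_smul_comm, ← mul_assoc, ← map_mul, of_mul_borelSum_congr]
  rw [← mul_assoc, mem_borel]
  intro i j hij
  rw [conj_permGL_apply'] at hij
  exact (σ.injective (hh _ _ hij)).le

/-- With D = s x(t) + 1 - x(t⁻¹), one has D σ[B] = D sσ[B] for every σ: when σ⁻¹ i < σ⁻¹ j both
sides equal sσ[B]. As σ and sσ have opposite signs, the terms of D e cancel in pairs. -/
lemma swap_mul_rootElt_mul_steinbergElt {i j : Fin n} (h : i < j) {t : F} (ht : t ≠ 0) :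
    of R (GL (Fin n) F) (permGL n F (Equiv.swap i j) * rootElt h t) * steinbergElt n F R =
      of R (GL (Fin n) F) (rootElt h t⁻¹) * steinbergElt n F R - steinbergElt n F R := by
  set s := permGL n F (Equiv.swap i j) with hs
  let D : R[GL (Fin n) F] := of R _ (s * rootElt h t) + 1 - of R _ (rootElt h t⁻¹ : GL (Fin n) F)
  suffices hD : D * steinbergElt n F R = 0 by
    rw [sub_mul, add_mul, one_mul] at hD
    rw [← sub_eq_zero, ← hD]
    abel
  have base : ∀ σ : Equiv.Perm (Fin n), σ⁻¹ i < σ⁻¹ j →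
      D * (of R (GL (Fin n) F) (permGL n F σ) * borelSum n F R) =
        D * (of R (GL (Fin n) F) (permGL n F (Equiv.swap i j * σ)) * borelSum n F R) := by
    intro σ hσ
    have h1 : of R (GL (Fin n) F) (s * rootElt h t * permGL n F σ) * borelSum n F R =
        of R (GL (Fin n) F) (s * permGL n F σ) * borelSum n F R := by
      apply of_mul_borelSum_congr
      have := conj_mem_borel hσ (rootElt_support h t)
      convert this using 1
      group
    have h2 : of R (GL (Fin n) F) (rootElt h t⁻¹ * permGL n F σ) * borelSum n F R =
        of R (GL (Fin n) F) (permGL n F σ) * borelSum n F R := by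
      apply of_mul_borelSum_congr
      have := conj_mem_borel hσ (rootElt_support h t⁻¹)
      convert this using 1
      group
    have h3 : of R (GL (Fin n) F) (s * rootElt h t * (s * permGL n F σ)) * borelSum n F R =
        of R (GL (Fin n) F) (rootElt h t⁻¹ * (s * permGL n F σ)) * borelSum n F R := by
      apply of_mul_borelSum_congr
      have := conj_mem_borel hσ (rankOneFactor_support h ht)
      convert this using 1
      rw [← mul_assoc (s * _) s, rankOne_relation h t, ← hs]
      group
    have expand : ∀ g : GL (Fin n) F, D * (of R (GL (Fin n) F) g * borelSum n F R) =
        of R (GL (Fin n) F) (s * rootElt h t * g) * borelSum n F R +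
        of R (GL (Fin n) F) g * borelSum n F R -
        of R (GL (Fin n) F) (rootElt h t⁻¹ * g) * borelSum n F R := by
      intro g
      rw [sub_mul, add_mul, one_mul, ← mul_assoc, ← mul_assoc, ← map_mul, ← map_mul]
    rw [map_mul (permGL n F), ← hs, expand, expand, h1, h2, h3]
    abel
  have hinv : ∀ σ : Equiv.Perm (Fin n), (Equiv.swap i j * σ)⁻¹ i = σ⁻¹ j ∧
      (Equiv.swap i j * σ)⁻¹ j = σ⁻¹ i := fun σ => by simp [mul_inv_rev]
  have all : ∀ σ : Equiv.Perm (Fin n),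
      D * (of R (GL (Fin n) F) (permGL n F σ) * borelSum n F R) =
        D * (of R (GL (Fin n) F) (permGL n F (Equiv.swap i j * σ)) * borelSum n F R) := by
    intro σ
    rcases lt_or_gt_of_ne (σ⁻¹.injective.ne h.ne) with hlt | hgt
    · exact base σ hlt
    · have := base (Equiv.swap i j * σ) (by rw [(hinv σ).1, (hinv σ).2]; exact hgt)
      rw [← mul_assoc (Equiv.swap i j), Equiv.swap_mul_self, one_mul] at this
      exact this.symm
  rw [steinbergElt_eq, Finset.mul_sum]
  refine Finset.sum_involution (fun σ _ => Equiv.swap i j * σ) (fun σ _ => ?_) (fun σ _ _ heq => ?_)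
    (fun σ _ => Finset.mem_univ _) (fun σ _ => ?_)
  · rw [mul_smul_comm, mul_smul_comm, ← all σ, ← add_smul, map_mul, Equiv.Perm.sign_swap h.ne]
    simp
  · have : Equiv.swap i j = 1 := mul_eq_right.1 heq
    exact h.ne (Equiv.swap_eq_one_iff.1 this)
  · rw [← mul_assoc, Equiv.swap_mul_self, one_mul]

variable (n F R) in
/-- The `R`-span of the elements `u e`, `u ∈ U`. -/
noncomputable def unitriSpan : Submodule R R[GL (Fin n) F] :=
  Submodule.span R (Set.range fun u : unitri n F =>
    of R (GL (Fin n) F) (u : GL (Fin n) F) * steinbergElt n F R)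

lemma of_mul_steinbergElt_mem {u : GL (Fin n) F} (hu : u ∈ unitri n F) :
    of R (GL (Fin n) F) u * steinbergElt n F R ∈ unitriSpan n F R :=
  Submodule.subset_span ⟨⟨u, hu⟩, rfl⟩

lemma steinbergElt_mem_unitriSpan : steinbergElt n F R ∈ unitriSpan n F R := by
  have := of_mul_steinbergElt_mem (R := R) (one_mem (unitri n F))
  rwa [map_one, one_mul] at this

lemma unitri_mul_mem_unitriSpan {u : GL (Fin n) F} (hu : u ∈ unitri n F) {z : R[GL (Fin n) F]}
    (hz : z ∈ unitriSpan n F R) : of R (GL (Fin n) F) u * z ∈ unitriSpan n F R := by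
  induction hz using Submodule.span_induction with
  | mem z hz =>
    obtain ⟨v, rfl⟩ := hz
    simp only
    rw [← mul_assoc, ← map_mul]
    exact of_mul_steinbergElt_mem (mul_mem hu v.2)
  | zero => simp
  | add x y _ _ hx hy => rw [mul_add]; exact add_mem hx hy
  | smul c x _ hx => rw [mul_smul_comm]; exact Submodule.smul_mem _ _ hx

/-- Split u = v x(t) with v trivial at the simple root. Then s v s stays in U, and s x(t) e is a
combination of x(t⁻¹) e and e, or ±e when t = 0. -/
lemma swap_mul_mem_unitriSpan {i j : Fin n} (hij : i.val + 1 = j.val) {z : R[GL (Fin n) F]}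
    (hz : z ∈ unitriSpan n F R) :
    of R (GL (Fin n) F) (permGL n F (Equiv.swap i j)) * z ∈ unitriSpan n F R := by
  have h : i < j := by rw [Fin.lt_def]; omega
  induction hz using Submodule.span_induction with
  | mem z hz =>
    obtain ⟨u, rfl⟩ := hz
    set s := permGL n F (Equiv.swap i j) with hs
    have hss : s * s = 1 := permGL_swap_mul_self i j
    set t := ((u : GL (Fin n) F) : Matrix (Fin n) (Fin n) F) i j with ht
    set v : GL (Fin n) F := u * (rootElt h (-t) : GL (Fin n) F) with hv
    have hvU : v ∈ unitri n F := mul_mem u.2 (rootElt h (-t)).2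
    have hv0 : (v : Matrix (Fin n) (Fin n) F) i j = 0 := by
      rw [hv, Units.val_mul, rootElt_coe, Matrix.mul_transvection_apply_same, u.2.2 i]
      simp [t]
    have hconj : s * v * s ∈ unitri n F := by
      refine ⟨conj_swap_mem_borel hij hvU.1 hv0, fun k => ?_⟩
      rw [hs, mul_permGL_apply, permGL_mul_apply, Equiv.swap_inv]
      exact hvU.2 _
    have hsu : s * u = s * v * s * (s * (rootElt h t : GL (Fin n) F)) := by
      have hu : (u : GL (Fin n) F) = v * (rootElt h t : GL (Fin n) F) := by
        rw [hv, rootElt_neg, Subgroup.coe_inv, inv_mul_cancel_right]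
      rw [mul_assoc (s * v), ← mul_assoc s s, hss, one_mul, mul_assoc, ← hu]
    simp only
    rw [← mul_assoc, ← map_mul, hsu, map_mul, mul_assoc]
    refine unitri_mul_mem_unitriSpan hconj ?_
    by_cases ht0 : t = 0
    · rw [ht0, rootElt_zero, Subgroup.coe_one, mul_one, permGL_mul_steinbergElt]
      refine Submodule.smul_mem _ _ ?_
      exact steinbergElt_mem_unitriSpan
    · rw [swap_mul_rootElt_mul_steinbergElt h ht0]
      refine sub_mem (of_mul_steinbergElt_mem (rootElt h _).2) ?_
      exact steinbergElt_mem_unitriSpan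
  | zero => simp
  | add x y _ _ hx hy => rw [mul_add]; exact add_mem hx hy
  | smul c x _ hx => rw [mul_smul_comm]; exact Submodule.smul_mem _ _ hx

/-- Induction on permutations through fundamental transpositions. -/
lemma perm_adjacent_induction {p : Equiv.Perm (Fin n) → Prop} (one : p 1)
    (swap_mul : ∀ (i j : Fin n) (σ), i.val + 1 = j.val → p σ → p (Equiv.swap i j * σ))
    (σ : Equiv.Perm (Fin n)) : p σ := by
  rcases n with _ | n
  · rwa [Subsingleton.elim σ 1]
  have hσ : σ ∈ Submonoid.closure (Set.range fun i : Fin n => Equiv.swap i.castSucc i.succ) := by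
    rw [Equiv.Perm.mclosure_swap_castSucc_succ]
    trivial
  induction hσ using Submonoid.closure_induction_left with
  | one => exact one
  | mul_left x hx y _ ih =>
    obtain ⟨i, rfl⟩ := hx
    exact swap_mul _ _ _ (by simp) ih

lemma permGL_mul_mem_unitriSpan (w : Equiv.Perm (Fin n)) {z : R[GL (Fin n) F]}
    (hz : z ∈ unitriSpan n F R) :
    of R (GL (Fin n) F) (permGL n F w) * z ∈ unitriSpan n F R := by
  induction w using perm_adjacent_induction with
  | one => rwa [map_one, map_one, one_mul]
  | swap_mul i j σ hij ih =>
    rw [map_mul, map_mul, mul_assoc]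
    exact swap_mul_mem_unitriSpan hij ih

open Classical in
/-- The operator `∑ lam(u) u` in the group algebra. -/
noncomputable def charOp (lam : unitri n F →* Rˣ) : R[GL (Fin n) F] :=
  ∑ u : unitri n F, MonoidAlgebra.single (u : GL (Fin n) F) ((lam u : Rˣ) : R)

lemma coe_charElt (lam : unitri n F →* Rˣ) :
    (charElt lam : R[GL (Fin n) F]) = charOp lam * steinbergElt n F R := by
  rw [charElt, charOp, Finset.sum_mul, AddSubmonoidClass.coe_finsetSum]
  rfl

lemma charOp_mul_of (lam : unitri n F →* Rˣ) (u : unitri n F) :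
    charOp lam * of R (GL (Fin n) F) (u : GL (Fin n) F) =
      ((lam u)⁻¹ : Rˣ).val • charOp lam := by
  classical
  rw [charOp, Finset.sum_mul, Finset.smul_sum]
  refine Fintype.sum_equiv (Equiv.mulRight u) _ _ fun v => ?_
  rw [MonoidAlgebra.of_apply, MonoidAlgebra.single_mul_single, MonoidAlgebra.smul_single, mul_one,
    Equiv.coe_mulRight, map_mul, Units.val_mul, Subgroup.coe_mul, smul_eq_mul,
    mul_comm, mul_assoc, Units.mul_inv, mul_one]

/-- Elements of U are absorbed as scalars on the right of A_λ, so only the multiple of e survives.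
-/
lemma charOp_mul_unitriSpan (lam : unitri n F →* Rˣ) {z : R[GL (Fin n) F]}
    (hz : z ∈ unitriSpan n F R) :
    ∃ c : R, charOp lam * z = c • (charOp lam * steinbergElt n F R) := by
  induction hz using Submodule.span_induction with
  | mem z hz =>
    obtain ⟨u, rfl⟩ := hz
    refine ⟨((lam u)⁻¹ : Rˣ).val, ?_⟩
    simp only
    rw [← mul_assoc, charOp_mul_of, smul_mul_assoc]
  | zero => exact ⟨0, by simp⟩
  | add x y _ _ hx hy =>
    obtain ⟨c, hc⟩ := hx
    obtain ⟨d, hd⟩ := hy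
    exact ⟨c + d, by rw [mul_add, hc, hd, add_smul]⟩
  | smul a x _ hx =>
    obtain ⟨c, hc⟩ := hx
    exact ⟨a * c, by rw [mul_smul_comm, hc, mul_smul]⟩

open Classical in
lemma coeff_borelSum (h : GL (Fin n) F) :
    (borelSum n F R).coeff h = if h ∈ borel n F then 1 else 0 := by
  rw [borelSum, MonoidAlgebra.coeff_sum, Finsupp.finsetSum_apply]
  simp only [MonoidAlgebra.of_apply, MonoidAlgebra.coeff_single, Finsupp.single_apply]
  split_ifs with hh
  · rw [Finset.sum_eq_single (⟨h, hh⟩ : borel n F)]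
    · simp
    · intro b _ hb
      rw [if_neg]
      rintro rfl
      exact hb rfl
    · simp
  · refine Finset.sum_eq_zero fun b _ => if_neg ?_
    rintro rfl
    exact hh b.2

open Classical in
lemma coeff_steinbergElt (h : GL (Fin n) F) :
    (steinbergElt n F R).coeff h = ∑ σ : Equiv.Perm (Fin n),
      if (permGL n F σ)⁻¹ * h ∈ borel n F then ((Equiv.Perm.sign σ : ℤ) : R) else 0 := by
  rw [steinbergElt_eq, MonoidAlgebra.coeff_sum, Finsupp.finsetSum_apply]
  refine Finset.sum_congr rfl fun σ _ => ?_
  rw [MonoidAlgebra.coeff_smul_apply, coeff_of_mul, coeff_borelSum]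
  simp

open Classical in
lemma coeff_charOp_mul (lam : unitri n F →* Rˣ) (z : R[GL (Fin n) F]) (h : GL (Fin n) F) :
    (charOp lam * z).coeff h =
      ∑ u : unitri n F, ((lam u : Rˣ) : R) * z.coeff ((u : GL (Fin n) F)⁻¹ * h) := by
  rw [charOp, Finset.sum_mul, MonoidAlgebra.coeff_sum, Finsupp.finsetSum_apply]
  refine Finset.sum_congr rfl fun u _ => ?_
  rw [MonoidAlgebra.coeff_single_mul_eq_mul_coeff ((u : GL (Fin n) F)⁻¹ * h)]
  intro m _
  rw [eq_inv_mul_iff_mul_eq]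

end GroupAlgebra

/-! ### The unitriangular group is a p-group -/

section Unipotent

variable {n : ℕ} {F : Type*} [Field F]

/-- Cayley–Hamilton for the characteristic polynomial (X - 1)^n. -/
lemma unitri_sub_one_pow (u : unitri n F) :
    (((u : GL (Fin n) F) : Matrix (Fin n) (Fin n) F) - 1) ^ n = 0 := by
  have hu : (((u : GL (Fin n) F) : Matrix (Fin n) (Fin n) F)).BlockTriangular id := u.2.1
  have h := Matrix.aeval_self_charpoly ((u : GL (Fin n) F) : Matrix (Fin n) (Fin n) F)
  rw [Matrix.charpoly_of_isUpperTriangular _ hu] at h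
  simpa [u.2.2] using h

lemma isPGroup_unitri (p : ℕ) [Fact p.Prime] [CharP F p] : IsPGroup p (unitri n F) := by
  intro u
  refine ⟨n, ?_⟩
  rcases n with _ | n
  · exact Subsingleton.elim _ _
  ext1; ext1
  rw [Subgroup.coe_pow, Units.val_pow_eq_pow_val, Subgroup.coe_one, Units.val_one]
  -- In characteristic p, (u - 1)^(p^m) = u^(p^m) - 1; taking m to be the matrix size makes p^m
  -- exceed the nilpotency index.
  have h := sub_pow_char_pow_of_commute p (n := n + 1)
    (Commute.one_right ((u : GL (Fin (n + 1)) F) : Matrix (Fin (n + 1)) (Fin (n + 1)) F))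
  have hle : n + 1 ≤ p ^ (n + 1) := (Nat.lt_pow_self (Fact.out : p.Prime).one_lt).le
  rw [pow_eq_zero_of_le hle (unitri_sub_one_pow u), one_pow, eq_comm, sub_eq_zero] at h
  exact h

end Unipotent

/-! ### Reversing the order inside blocks -/

section BlockReversal

lemma perm_apply_inv_self {α : Type*} (σ : Equiv.Perm α) (x : α) : σ (σ⁻¹ x) = x :=
  σ.apply_symm_apply x

/-- For a monotone label there is a permutation that reverses the order in every block. -/
lemma exists_block_reversal {n : ℕ} {b : Fin n → ℕ} (hb : Monotone b) :
    ∃ τ : Equiv.Perm (Fin n), (∀ i, b (τ i) = b i) ∧ ∀ i j, i < j → b i = b j → τ j < τ i := by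
  -- Sorting by label first and by decreasing index second. As b is already sorted, the sorting
  -- permutation preserves labels.
  let f : Fin n → ℕ ×ₗ (Fin n)ᵒᵈ := fun i => toLex (b i, OrderDual.toDual i)
  let τ := Tuple.sort f
  have hmono : Monotone (f ∘ τ) := Tuple.monotone_sort f
  have hbτ : Monotone (b ∘ τ) := fun i j hij => by
    have := hmono hij
    rw [Function.comp_apply, Function.comp_apply, Prod.Lex.toLex_le_toLex] at this
    rcases this with h | h
    · exact h.le
    · exact h.1.le
  have hcomp : b ∘ τ = b := by
    have h1 : Monotone (b ∘ (1 : Equiv.Perm (Fin n))) := hb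
    exact Tuple.unique_monotone hbτ h1
  refine ⟨τ, fun i => congrFun hcomp i, fun i j hij hbij => ?_⟩
  have := hmono hij.le
  rw [Function.comp_apply, Function.comp_apply, Prod.Lex.toLex_le_toLex] at this
  have h1 : b (τ i) = b i := congrFun hcomp i
  have h2 : b (τ j) = b j := congrFun hcomp j
  rcases this with h | h
  · simp only at h
    omega
  · exact lt_of_le_of_ne h.2 (τ.injective.ne hij.ne')

end BlockReversal

/-! ### The scalar relating two characters -/

section Comparison

variable {n : ℕ} {F : Type*} [Field F] [Fintype F] {R : Type*} [CommRing R]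

open MonoidAlgebra (of)

lemma coeff_steinbergElt_permGL_inv_mul (w : Equiv.Perm (Fin n)) (h : GL (Fin n) F) :
    (steinbergElt n F R).coeff ((permGL n F w)⁻¹ * h) =
      ((Equiv.Perm.sign w : ℤ) : R) * (steinbergElt n F R).coeff h := by
  rw [← coeff_of_mul, permGL_mul_steinbergElt, MonoidAlgebra.coeff_smul_apply, smul_eq_mul]

/-- A term of e indexed by σ that hits x⁻¹k forces xσ ∈ P_b. The nonzero diagonal of x then forces σ
∈ P_b, and so x ∈ P_b. -/
lemma coeff_steinbergElt_eq_zero {b : Fin n → ℕ} (hb : Monotone b) {x k : GL (Fin n) F}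
    (hk : k ∈ blockUpper F b) (hx : ∀ i, (x : Matrix (Fin n) (Fin n) F) i i ≠ 0)
    (hxb : x ∉ blockUpper F b) : (steinbergElt n F R).coeff (x⁻¹ * k) = 0 := by
  rw [coeff_steinbergElt]
  refine Finset.sum_eq_zero fun σ _ => if_neg fun hσ => hxb ?_
  have h1 : x * permGL n F σ ∈ blockUpper F b := by
    have := mul_mem hk (inv_mem (borel_le_blockUpper hb hσ))
    convert this using 1
    group
  have h2 := permGL_mem_blockUpper (F := F) (label_of_mul_permGL_mem hx h1)
  simpa using mul_mem h1 (inv_mem h2)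

/-- Evaluate at the permutation τ that reverses every block. Only the term σ = τ of e contributes,
and only for u ∈ U with τ⁻¹u⁻¹τ ∈ B. Such u⁻¹ vanish at the simple roots inside blocks, so μ(u) = 1,
and the coefficient is ± a positive count, nonzero in characteristic 0. -/
lemma exists_coeff_charElt_ne_zero [CharZero R] [IsDomain R] {b : Fin n → ℕ} (hb : Monotone b)
    {μ : unitri n F →* Rˣ}
    (hμ : ∀ u : unitri n F, (∀ i j : Fin n, i.val + 1 = j.val → b i = b j →
      ((u : GL (Fin n) F) : Matrix (Fin n) (Fin n) F) i j = 0) → μ u = 1) :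
    ∃ h ∈ blockUpper F b, (charOp μ * steinbergElt n F R).coeff h ≠ 0 := by
  classical
  obtain ⟨τ, hτb, hτ⟩ := exists_block_reversal hb
  refine ⟨permGL n F τ, permGL_mem_blockUpper hτb, ?_⟩
  have huniq : ∀ (u : unitri n F) (σ : Equiv.Perm (Fin n)),
      (permGL n F σ)⁻¹ * ((u : GL (Fin n) F)⁻¹ * permGL n F τ) ∈ borel n F → σ = τ := by
    intro u σ h
    have key : ∀ a, a.val ≤ ((τ⁻¹ * σ) a).val := fun a => by
      refine mem_borel.1 h a _ ?_
      rw [← map_inv, permGL_mul_apply, mul_permGL_apply, inv_inv, Equiv.Perm.mul_apply,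
        perm_apply_inv_self]
      rw [(inv_mem u.2 : (u : GL (Fin n) F)⁻¹ ∈ unitri n F).2]
      exact one_ne_zero
    have : τ⁻¹ * σ = 1 := Equiv.ext fun a => Fin.ext (label_comp_perm (b := Fin.val) key a)
    exact (inv_mul_eq_one.1 this).symm
  have hval : ∀ u : unitri n F,
      (permGL n F τ)⁻¹ * ((u : GL (Fin n) F)⁻¹ * permGL n F τ) ∈ borel n F → μ u = 1 := by
    intro u h
    rw [← inv_eq_one, ← map_inv]
    refine hμ _ fun i j hij hbij => ?_
    by_contra hne
    have hij' : i < j := by rw [Fin.lt_def]; omega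
    have hle : τ⁻¹ i ≤ τ⁻¹ j := by
      refine mem_borel.1 h _ _ ?_
      rw [← map_inv, permGL_mul_apply, mul_permGL_apply, inv_inv, perm_apply_inv_self,
        perm_apply_inv_self]
      exact hne
    -- A nonzero entry at (i, j) would make τ⁻¹ keep i before j, although τ reverses their common
    -- block.
    have hlt : τ⁻¹ i < τ⁻¹ j := lt_of_le_of_ne hle (τ⁻¹.injective.ne hij'.ne)
    have hinv : ∀ k, b (τ⁻¹ k) = b k := fun k => by
      rw [← hτb (τ⁻¹ k), perm_apply_inv_self]
    have := hτ _ _ hlt (by rw [hinv, hinv, hbij])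
    rw [perm_apply_inv_self, perm_apply_inv_self] at this
    exact lt_asymm this hij'
  have hsum : (charOp μ * steinbergElt n F R).coeff (permGL n F τ) =
      ((Equiv.Perm.sign τ : ℤ) : R) * ((Finset.univ.filter fun u : unitri n F =>
        (permGL n F τ)⁻¹ * ((u : GL (Fin n) F)⁻¹ * permGL n F τ) ∈ borel n F).card : R) := by
    rw [coeff_charOp_mul, mul_comm, ← nsmul_eq_mul, ← Finset.sum_const, Finset.sum_filter]
    refine Finset.sum_congr rfl fun u _ => ?_
    rw [coeff_steinbergElt, Finset.sum_eq_single τ]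
    · split_ifs with h
      · rw [hval u h, Units.val_one, one_mul]
      · rw [mul_zero]
    · intro σ _ hσ
      exact if_neg fun h => hσ (huniq u σ h)
    · simp
  rw [hsum]
  refine mul_ne_zero (by simp) ?_
  rw [Nat.cast_ne_zero, Finset.card_ne_zero]
  exact ⟨1, by simp [one_mem]⟩

open Classical in
-- Move w past u at the cost of sg(w), so that each u acts through w u w⁻¹. If this lies outside P_b
-- the term vanishes; otherwise it is some v ∈ U with λ(u) = μ(v), and translating the sum for A_μ
-- by v gives the coefficient of E_μ again.
lemma coeff_charOp_mul_permGL_mul_charElt {b : Fin n → ℕ} (hb : Monotone b)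
    {μ lam : unitri n F →* Rˣ} {w : Equiv.Perm (Fin n)}
    (hw : ∀ u : unitri n F,
      permGL n F w * (u : GL (Fin n) F) * (permGL n F w)⁻¹ ∈ blockUpper F b →
      ∃ v : unitri n F, (v : GL (Fin n) F) = permGL n F w * (u : GL (Fin n) F) * (permGL n F w)⁻¹ ∧
        lam u = μ v) {h : GL (Fin n) F} (hh : h ∈ blockUpper F b) :
    (charOp μ * (of R (GL (Fin n) F) (permGL n F w) *
      (charOp lam * steinbergElt n F R))).coeff h =
      ((Equiv.Perm.sign w : ℤ) : R) * ((Finset.univ.filter fun u : unitri n F =>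
        permGL n F w * (u : GL (Fin n) F) * (permGL n F w)⁻¹ ∈ blockUpper F b).card : R) *
        (charOp μ * steinbergElt n F R).coeff h := by
  rw [coeff_charOp_mul]
  simp_rw [coeff_of_mul, coeff_charOp_mul lam, Finset.mul_sum]
  rw [Finset.sum_comm, mul_assoc, ← nsmul_eq_mul, ← Finset.sum_const, Finset.sum_filter,
    Finset.mul_sum]
  refine Finset.sum_congr rfl fun u _ => ?_
  have hconj : ∀ v : unitri n F, (steinbergElt n F R).coeff
      ((u : GL (Fin n) F)⁻¹ * ((permGL n F w)⁻¹ * ((v : GL (Fin n) F)⁻¹ * h))) =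
      ((Equiv.Perm.sign w : ℤ) : R) * (steinbergElt n F R).coeff
      ((permGL n F w * (u : GL (Fin n) F) * (permGL n F w)⁻¹)⁻¹ * ((v : GL (Fin n) F)⁻¹ * h)) := by
    intro v
    rw [← coeff_steinbergElt_permGL_inv_mul]
    congr 1
    group
  simp_rw [hconj]
  split_ifs with hu
  · obtain ⟨v, hv, hval⟩ := hw u hu
    rw [coeff_charOp_mul, Finset.mul_sum, hval, ← hv]
    refine Fintype.sum_equiv (Equiv.mulRight v) _ _ fun x => ?_
    rw [Equiv.coe_mulRight, map_mul μ, Subgroup.coe_mul, mul_inv_rev, Units.val_mul,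
      mul_assoc (v : GL (Fin n) F)⁻¹ _ h]
    ring
  · rw [mul_zero]
    refine Finset.sum_eq_zero fun v _ => ?_
    rw [coeff_steinbergElt_eq_zero hb (mul_mem (inv_mem (borel_le_blockUpper hb v.2.1)) hh) _ hu]
    · simp
    · intro i
      rw [conj_permGL_apply, u.2.2]
      exact one_ne_zero

lemma charElt_mem_unitriSpan (lam : unitri n F →* Rˣ) :
    charOp lam * steinbergElt n F R ∈ unitriSpan n F R := by
  classical
  rw [charOp, Finset.sum_mul]
  refine sum_mem fun u _ => ?_
  have : MonoidAlgebra.single (u : GL (Fin n) F) ((lam u : Rˣ) : R) =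
      ((lam u : Rˣ) : R) • of R (GL (Fin n) F) (u : GL (Fin n) F) := by simp
  rw [this, smul_mul_assoc]
  exact Submodule.smul_mem _ _ (of_mul_steinbergElt_mem u.2)

/-- The scalar c in A_μ w E_λ = c E_μ is ± the order of U ∩ w⁻¹P_b w, a power of p and hence a unit;
c⁻¹ A_μ w then carries E_λ to E_μ. -/
lemma charElt_mem_span_of_conj [CharZero R] [IsDomain R] (p : ℕ) [Fact p.Prime] [CharP F p]
    (hp : IsUnit (p : R)) {b : Fin n → ℕ} (hb : Monotone b)
    {μ lam : unitri n F →* Rˣ} {w : Equiv.Perm (Fin n)}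
    (hμ : ∀ u : unitri n F, (∀ i j : Fin n, i.val + 1 = j.val → b i = b j →
      ((u : GL (Fin n) F) : Matrix (Fin n) (Fin n) F) i j = 0) → μ u = 1)
    (hw : ∀ u : unitri n F,
      permGL n F w * (u : GL (Fin n) F) * (permGL n F w)⁻¹ ∈ blockUpper F b →
      ∃ v : unitri n F, (v : GL (Fin n) F) = permGL n F w * (u : GL (Fin n) F) * (permGL n F w)⁻¹ ∧
        lam u = μ v) :
    charElt μ ∈ Submodule.span R[GL (Fin n) F] {charElt lam} := by
  classical
  obtain ⟨c, hc⟩ := charOp_mul_unitriSpan μ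
    (permGL_mul_mem_unitriSpan w (charElt_mem_unitriSpan lam))
  obtain ⟨h, hh, hne⟩ := exists_coeff_charElt_ne_zero hb hμ
  have hcoeff := coeff_charOp_mul_permGL_mul_charElt hb hw hh
  rw [hc, MonoidAlgebra.coeff_smul_apply, smul_eq_mul] at hcoeff
  have hcval := mul_right_cancel₀ hne hcoeff
  have hunit : IsUnit c := by
    rw [hcval]
    refine IsUnit.mul ?_ ?_
    · exact ((Equiv.Perm.sign w).isUnit.map (Int.castRingHom R))
    · let S : Subgroup (unitri n F) := (blockUpper F b).comap
        ((MulAut.conj (permGL n F w)).toMonoidHom.comp (unitri n F).subtype)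
      obtain ⟨k, hk⟩ := IsPGroup.iff_card.1 ((isPGroup_unitri (n := n) (F := F) p).to_subgroup S)
      have hS : (Finset.univ.filter fun u : unitri n F =>
          permGL n F w * (u : GL (Fin n) F) * (permGL n F w)⁻¹ ∈ blockUpper F b).card = p ^ k := by
        rw [← hk, Nat.card_eq_fintype_card, Fintype.card_subtype]
        congr 1
      rw [hS, Nat.cast_pow]
      exact hp.pow k
  obtain ⟨d, rfl⟩ := hunit
  rw [Submodule.mem_span_singleton]
  refine ⟨(d⁻¹ : Rˣ).val • (charOp μ * of R (GL (Fin n) F) (permGL n F w)), ?_⟩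
  ext1
  rw [Submodule.coe_smul, smul_eq_mul, coe_charElt, coe_charElt, smul_mul_assoc, mul_assoc, hc,
    smul_smul, Units.inv_mul, one_smul]

end Comparison

/-! ### Characters of U built from one additive character -/

section StandardCharacters

variable {n : ℕ} {F : Type*} [Field F] {R : Type*} [CommRing R]

open Classical in
/-- The sum of the entries of a matrix at the simple roots selected by `J`. -/
noncomputable def simpleSum (J : Fin n → Fin n → Prop) (M : Matrix (Fin n) (Fin n) F) : F :=
  ∑ i, ∑ j, if i.val + 1 = j.val ∧ J i j then M i j else 0

lemma unitri_mul_apply_adjacent (u v : unitri n F) {i j : Fin n} (hij : i.val + 1 = j.val) :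
    ((u * v : unitri n F) : GL (Fin n) F).val i j =
      (u : GL (Fin n) F).val i j + (v : GL (Fin n) F).val i j := by
  have hne : i ≠ j := fun h => by rw [h] at hij; omega
  rw [Subgroup.coe_mul, Units.val_mul, Matrix.mul_apply,
    -- Triangularity forces i ≤ k ≤ j in the product, and nothing lies strictly between adjacent
    -- indices.
    ← Finset.sum_subset (Finset.subset_univ {i, j}), Finset.sum_pair hne, u.2.2, v.2.2, one_mul,
    mul_one, add_comm]
  intro k _ hk
  rw [Finset.mem_insert, Finset.mem_singleton, not_or] at hk
  by_contra h
  have h1 := mem_borel.1 u.2.1 i k (left_ne_zero_of_mul h)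
  have h2 := mem_borel.1 v.2.1 k j (right_ne_zero_of_mul h)
  simp only [Fin.le_def, Fin.ext_iff] at *
  omega

lemma simpleSum_mul (J : Fin n → Fin n → Prop) (u v : unitri n F) :
    simpleSum J ((u * v : unitri n F) : GL (Fin n) F).val =
      simpleSum J (u : GL (Fin n) F).val + simpleSum J (v : GL (Fin n) F).val := by
  simp only [simpleSum, ← Finset.sum_add_distrib]
  refine Finset.sum_congr rfl fun i _ => Finset.sum_congr rfl fun j _ => ?_
  split_ifs with h
  · exact unitri_mul_apply_adjacent u v h.1
  · rw [add_zero]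

/-- The linear character of `U` that is `ψ` on the simple root subgroups selected by `J` and
trivial on the others. -/
noncomputable def stdChar (ψ : AddChar F Rˣ) (J : Fin n → Fin n → Prop) : unitri n F →* Rˣ where
  toFun u := ψ (simpleSum J (u : GL (Fin n) F).val)
  map_one' := by
    rw [simpleSum, Finset.sum_eq_zero, AddChar.map_zero_eq_one]
    refine fun i _ => Finset.sum_eq_zero fun j _ => ?_
    split_ifs with h
    · refine Matrix.one_apply_ne fun h' => ?_
      have := h.1
      rw [h'] at this
      omega
    · rfl
  map_mul' u v := by rw [simpleSum_mul, AddChar.map_add_eq_mul]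

lemma stdChar_apply (ψ : AddChar F Rˣ) (J : Fin n → Fin n → Prop) (u : unitri n F) :
    stdChar ψ J u = ψ (simpleSum J (u : GL (Fin n) F).val) := rfl

lemma stdChar_congr (ψ : AddChar F Rˣ) {J J' : Fin n → Fin n → Prop}
    (h : ∀ i j, i.val + 1 = j.val → (J i j ↔ J' i j)) : stdChar ψ J = stdChar ψ J' := by
  ext u
  rw [stdChar_apply, stdChar_apply, simpleSum, simpleSum]
  congr 2
  refine Finset.sum_congr rfl fun i _ => Finset.sum_congr rfl fun j _ => ?_
  classical exact if_congr (and_congr_right (h i j)) rfl rfl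

open Classical in
lemma stdChar_rootElt (ψ : AddChar F Rˣ) (J : Fin n → Fin n → Prop) {i j : Fin n} (h : i < j)
    (hij : i.val + 1 = j.val) (a : F) :
    stdChar ψ J (rootElt h a) = if J i j then ψ a else 1 := by
  have hne : ∀ k l : Fin n, k.val + 1 = l.val → ((k = l) = False) := fun k l hkl => by
    rw [eq_iff_iff, iff_false, Fin.ext_iff]; omega
  rw [stdChar_apply, simpleSum, Finset.sum_eq_single i, Finset.sum_eq_single j, rootElt_coe,
    transvection_apply]
  · simp only [hij, true_and, and_self, if_true, if_neg h.ne, zero_add]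
    split_ifs <;> simp
  · intro l _ hl
    rw [if_neg]
    intro h'
    exact hl (Fin.ext (by omega))
  · simp
  · intro k _ hk
    refine Finset.sum_eq_zero fun l _ => ?_
    split_ifs with h'
    · rw [rootElt_coe, transvection_apply]
      simp [hne k l h'.1, Ne.symm hk]
    · rfl
  · simp

end StandardCharacters

/-! ### Permutations that move blocks -/

section BlockMaps

variable {n : ℕ}

/-- A permutation that carries the blocks of `b'` onto the blocks of `b` monotonically preserves
adjacency inside the blocks. -/
lemma adjacent_iff_of_block_map {b b' : Fin n → ℕ} (hb : Monotone b) (hb' : Monotone b')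
    {w : Equiv.Perm (Fin n)} (hw : ∀ i j, b (w i) = b (w j) ↔ b' i = b' j)
    (ho : ∀ i j, i < j → b' i = b' j → w i < w j) {i j : Fin n} (hij : b' i = b' j) :
    (w i).val + 1 = (w j).val ↔ i.val + 1 = j.val := by
  constructor
  · intro h
    have hlt : i < j := by
      rcases lt_trichotomy i j with h1 | h1 | h1
      · exact h1
      · rw [h1] at h; omega
      · have := ho _ _ h1 hij.symm
        rw [Fin.lt_def] at this; omega
    by_contra hne
    have hk : i.val + 1 < n := by have := j.2; rw [Fin.lt_def] at hlt; omega
    let k : Fin n := ⟨i.val + 1, hk⟩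
    have hik : i < k := by rw [Fin.lt_def]; simp [k]
    have hkj : k < j := by rw [Fin.lt_def] at *; simp only [k]; omega
    -- Blocks of a monotone label are intervals, so an index between i and j lies in their block,
    -- and its image would lie strictly between adjacent indices.
    have hbk : b' i = b' k := le_antisymm (hb' hik.le) (hij ▸ hb' hkj.le)
    have h1 := ho _ _ hik hbk
    have h2 := ho _ _ hkj (hbk.symm.trans hij)
    rw [Fin.lt_def] at h1 h2
    omega
  · intro h
    have hlt : i < j := by rw [Fin.lt_def]; omega
    have hwlt := ho _ _ hlt hij
    by_contra hne
    have hz : (w i).val + 1 < n := by have := (w j).2; rw [Fin.lt_def] at hwlt; omega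
    let z : Fin n := ⟨(w i).val + 1, hz⟩
    have hiz : w i < z := by rw [Fin.lt_def]; simp [z]
    have hzj : z < w j := by rw [Fin.lt_def] at *; simp only [z]; omega
    have hbz : b (w i) = b z := le_antisymm (hb hiz.le) (((hw i j).2 hij) ▸ hb hzj.le)
    obtain ⟨k, hk⟩ := w.surjective z
    rw [← hk] at hiz hzj hbz
    have hik : b' i = b' k := (hw i k).1 hbz
    have h1 : i < k := by
      rcases lt_trichotomy i k with h1 | h1 | h1
      · exact h1
      · rw [h1] at hiz; exact absurd hiz (lt_irrefl _)
      · exact absurd (ho _ _ h1 hik.symm) hiz.not_gt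
    have h2 : k < j := by
      rcases lt_trichotomy k j with h1 | h1 | h1
      · exact h1
      · rw [h1] at hzj; exact absurd hzj (lt_irrefl _)
      · exact absurd (ho _ _ h1 (hij.symm.trans hik)) hzj.not_gt
    rw [Fin.lt_def] at h1 h2
    omega

/-- Every set of simple roots is the set of simple roots of a block structure. -/
lemma exists_label (J : Fin n → Fin n → Prop) :
    ∃ b : Fin n → ℕ, Monotone b ∧ ∀ i j : Fin n, i.val + 1 = j.val → (b i = b j ↔ J i j) := by
  classical
  -- The cuts (adjacent pairs outside J) up to k; their number is the label.
  let S : Fin n → Finset (Fin n) := fun k =>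
    Finset.univ.filter fun m => ∃ m' : Fin n, m.val + 1 = m'.val ∧ m' ≤ k ∧ ¬ J m m'
  have hS : Monotone S := fun k l hkl => by
    intro m hm
    simp only [S, Finset.mem_filter, Finset.mem_univ, true_and] at hm ⊢
    obtain ⟨m', h1, h2, h3⟩ := hm
    exact ⟨m', h1, h2.trans hkl, h3⟩
  refine ⟨fun k => (S k).card, fun k l hkl => Finset.card_le_card (hS hkl), fun i j hij => ?_⟩
  have hlt : i < j := by rw [Fin.lt_def]; omega
  constructor
  · intro h
    by_contra hJ
    have heq := Finset.eq_of_subset_of_card_le (hS hlt.le) h.ge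
    have hmem : i ∈ S j := by
      simp only [S, Finset.mem_filter, Finset.mem_univ, true_and]
      exact ⟨j, hij, le_rfl, hJ⟩
    rw [← heq] at hmem
    simp only [S, Finset.mem_filter, Finset.mem_univ, true_and] at hmem
    obtain ⟨m', h1, h2, _⟩ := hmem
    rw [Fin.le_def] at h2
    omega
  · intro h
    refine congrArg Finset.card (Finset.Subset.antisymm (hS hlt.le) fun m hm => ?_)
    simp only [S, Finset.mem_filter, Finset.mem_univ, true_and] at hm ⊢
    obtain ⟨m', h1, h2, h3⟩ := hm
    refine ⟨m', h1, ?_, h3⟩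
    by_contra hlt'
    rw [Fin.le_def] at *
    have hm' : m' = j := Fin.ext (by omega)
    have hm : m = i := Fin.ext (by omega)
    rw [hm', hm] at h3
    exact h3 h

lemma monotone_index (c : Composition n) : Monotone c.index := by
  intro i j hij
  by_contra hlt
  have h1 := c.monotone_sizeUpTo (Nat.succ_le_of_lt (not_le.1 hlt))
  have h2 := c.sizeUpTo_index_le i
  have h3 := c.lt_sizeUpTo_index_succ j
  rw [Fin.val_succ] at h3
  rw [Fin.le_def] at hij
  simp only [Nat.succ_eq_add_one] at h1
  omega

/-- Rearranging the blocks of a composition is realized by a permutation. -/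
lemma exists_block_map {a b : Composition n} (hab : List.Perm a.blocks b.blocks) :
    ∃ w : Equiv.Perm (Fin n),
      (∀ i j, a.index (w i) = a.index (w j) ↔ b.index i = b.index j) ∧
      ∀ i j, i < j → b.index i = b.index j → w i < w j := by
  obtain ⟨π, hπ⟩ : ∃ π : Fin b.length ≃ Fin a.length, ∀ k, b.blocksFun k = a.blocksFun (π k) := by
    refine ⟨⟨hab.symm.idxBij, hab.idxBij, hab.idxBij_leftInverse_idxBij_symm,
      hab.idxBij_rightInverse_idxBij_symm⟩, fun k => ?_⟩
    exact (hab.symm.getElem_idxBij_eq_getElem k).symm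
  -- Blocks are matched by a size-preserving bijection π, and positions inside a block are kept.
  let w : Equiv.Perm (Fin n) := b.blocksFinEquiv.symm.trans
    ((Equiv.sigmaCongr π fun k => finCongr (hπ k)).trans a.blocksFinEquiv)
  have hwval : ∀ i, w i = a.embedding (π (b.index i)) (finCongr (hπ _) (b.invEmbedding i)) :=
    fun i => rfl
  have hidx : ∀ i, a.index (w i) = π (b.index i) := fun i => by
    rw [hwval, Composition.index_embedding]
  refine ⟨w, fun i j => ?_, fun i j hij h => ?_⟩
  · rw [hidx, hidx, π.injective.eq_iff]
  · have hle := b.sizeUpTo_index_le i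
    have hle' := b.sizeUpTo_index_le j
    rw [Fin.lt_def, hwval, hwval, Composition.coe_embedding, Composition.coe_embedding]
    simp only [finCongr_apply, Fin.val_cast, Composition.coe_invEmbedding]
    rw [h] at hle ⊢
    rw [Fin.lt_def] at hij
    omega

end BlockMaps

/-! ### Inclusions between the submodules for standard characters -/

section Inclusions

variable {n : ℕ} {F : Type*} [Field F] [Fintype F] {R : Type*} [CommRing R] [IsDomain R]
  [CharZero R]

/-- If w u w⁻¹ ∈ P_b, then u can have a nonzero entry at (i, j) only when b (w i) ≤ b (w j). So J
has to match the blocks of b' only at such pairs and is free at the other simple roots; this freedom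
is what permits a larger support. -/
lemma charElt_stdChar_mem_span (p : ℕ) [Fact p.Prime] [CharP F p] (hp : IsUnit (p : R))
    (ψ : AddChar F Rˣ) {b b' : Fin n → ℕ} (hb : Monotone b) (hb' : Monotone b')
    {w : Equiv.Perm (Fin n)} (hw : ∀ i j, b (w i) = b (w j) ↔ b' i = b' j)
    (ho : ∀ i j, i < j → b' i = b' j → w i < w j) {K J : Fin n → Fin n → Prop}
    (hK : ∀ i j : Fin n, i.val + 1 = j.val → (K i j ↔ b i = b j))
    (hJ : ∀ i j : Fin n, i.val + 1 = j.val → b (w i) ≤ b (w j) → (J i j ↔ b' i = b' j)) :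
    charElt (stdChar ψ K) ∈ Submodule.span R[GL (Fin n) F] {charElt (stdChar ψ J)} := by
  refine charElt_mem_span_of_conj p hp hb (w := w) (fun u hu => ?_) (fun u hu => ?_)
  · rw [stdChar_apply, simpleSum, Finset.sum_eq_zero, AddChar.map_zero_eq_one]
    refine fun i _ => Finset.sum_eq_zero fun j _ => ?_
    split_ifs with h
    · exact hu i j h.1 ((hK i j h.1).1 h.2)
    · rfl
  · have hentry : ∀ i j, (permGL n F w * (u : GL (Fin n) F) * (permGL n F w)⁻¹).val (w i) (w j) =
        (u : GL (Fin n) F).val i j := fun i j => by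
      rw [conj_permGL_apply]
      simp
    have hsupp : ∀ i j, (u : GL (Fin n) F).val i j ≠ 0 → i ≤ j ∧ b (w i) ≤ b (w j) :=
      fun i j hij => ⟨mem_borel.1 u.2.1 i j hij,
        mem_blockUpper.1 hu _ _ (by rw [hentry]; exact hij)⟩
    refine ⟨⟨permGL n F w * (u : GL (Fin n) F) * (permGL n F w)⁻¹, ?_, ?_⟩, rfl, ?_⟩
    · rw [mem_borel]
      intro x y hxy
      obtain ⟨i, rfl⟩ := w.surjective x
      obtain ⟨j, rfl⟩ := w.surjective y
      rw [hentry] at hxy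
      obtain ⟨h1, h2⟩ := hsupp i j hxy
      -- Entries between different blocks are ordered by the label; inside a block w preserves the
      -- order.
      rcases h2.lt_or_eq with h2 | h2
      · exact (hb.reflect_lt h2).le
      · rcases h1.lt_or_eq with h1 | rfl
        · exact (ho i j h1 ((hw i j).1 h2)).le
        · exact le_rfl
    · intro x
      rw [conj_permGL_apply]
      exact u.2.2 _
    · rw [stdChar_apply, stdChar_apply, simpleSum, simpleSum]
      congr 1
      conv_rhs => rw [← Equiv.sum_comp w]
      refine Finset.sum_congr rfl fun i _ => ?_
      conv_rhs => rw [← Equiv.sum_comp w]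
      refine Finset.sum_congr rfl fun j _ => ?_
      simp only [hentry]
      by_cases h0 : (u : GL (Fin n) F).val i j = 0
      · rw [h0, ite_self, ite_self]
      · obtain ⟨h1, h2⟩ := hsupp i j h0
        classical
        refine if_congr ⟨fun h => ?_, fun h => ?_⟩ rfl rfl
        · have hbij := (hJ i j h.1 h2).1 h.2
          have hadj := (adjacent_iff_of_block_map hb hb' hw ho hbij).2 h.1
          exact ⟨hadj, (hK _ _ hadj).2 ((hw i j).2 hbij)⟩
        · have hbij := (hw i j).1 ((hK _ _ h.1).1 h.2)
          have hadj := (adjacent_iff_of_block_map hb hb' hw ho hbij).1 h.1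
          exact ⟨hadj, (hJ i j hadj h2).2 hbij⟩

lemma charElt_stdChar_mem_span_rev (p : ℕ) [Fact p.Prime] [CharP F p] (hp : IsUnit (p : R))
    (ψ : AddChar F Rˣ) {K J : Fin n → Fin n → Prop}
    (hKJ : ∀ i j : Fin n, i.val + 1 = j.val → K i j → J i j) :
    charElt (stdChar ψ K) ∈
      Submodule.span R[GL (Fin n) F] {charElt (stdChar ψ fun i j => J j.rev i.rev)} := by
  obtain ⟨b, hb, hbK⟩ := exists_label K
  obtain ⟨τ, hτb, hτ⟩ := exists_block_reversal hb
  -- The total bounds every label, so the truncated subtraction that reverses labels loses no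
  -- information.
  have hbound : ∀ i, b i ≤ ∑ k, b k := fun i =>
    Finset.single_le_sum (f := b) (fun _ _ => Nat.zero_le _) (Finset.mem_univ i)
  have hrev : ∀ i j : Fin n, (∑ k, b k) - b i.rev = (∑ k, b k) - b j.rev ↔ b i.rev = b j.rev :=
    fun i j => by
      have h1 := hbound i.rev
      have h2 := hbound j.rev
      omega
  -- τ ∘ rev reverses the sequence of blocks and, by the double reversal, keeps the order inside
  -- each one.
  refine charElt_stdChar_mem_span p hp ψ (b' := fun i => (∑ k, b k) - b i.rev)
    (w := τ * Fin.revPerm) hb ?_ ?_ ?_ (fun i j hij => (hbK i j hij).symm) ?_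
  · intro i j hij
    exact Nat.sub_le_sub_left (hb (Fin.rev_le_rev.2 hij)) _
  · intro i j
    simp only [Equiv.Perm.mul_apply, Fin.revPerm_apply, hτb, hrev]
  · intro i j hij h
    simp only [Equiv.Perm.mul_apply, Fin.revPerm_apply, hrev] at h ⊢
    exact hτ _ _ (Fin.rev_lt_rev.2 hij) h.symm
  · intro i j hij hle
    simp only [Equiv.Perm.mul_apply, Fin.revPerm_apply, hτb, hrev] at hle ⊢
    have hadj : j.rev.val + 1 = i.rev.val := by
      rw [Fin.val_rev, Fin.val_rev]
      have := j.2
      omega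
    -- Across a block boundary the label strictly drops, so the only constrained adjacent pairs lie
    -- inside a block, where K and hence J holds.
    have heq : b i.rev = b j.rev := le_antisymm hle (hb (by rw [Fin.le_def]; omega))
    exact ⟨fun _ => heq, fun _ => hKJ _ _ hadj ((hbK _ _ hadj).1 heq.symm)⟩

/-- The submodule generated by `E_λ` grows with the support of `λ`. -/
lemma charElt_stdChar_mem_span_of_le (p : ℕ) [Fact p.Prime] [CharP F p] (hp : IsUnit (p : R))
    (ψ : AddChar F Rˣ) {K J : Fin n → Fin n → Prop}
    (hKJ : ∀ i j : Fin n, i.val + 1 = j.val → K i j → J i j) :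
    charElt (stdChar ψ K) ∈ Submodule.span R[GL (Fin n) F] {charElt (stdChar ψ J)} := by
  have h1 := charElt_stdChar_mem_span_rev p hp ψ hKJ
  -- Applied to the reversed J itself, the same step turns the reversal back.
  have h2 := charElt_stdChar_mem_span_rev p hp ψ
    (K := fun i j => J j.rev i.rev) (J := fun i j => J j.rev i.rev) fun _ _ _ h => h
  simp only [Fin.rev_rev] at h2
  exact Submodule.span_le.2 (Set.singleton_subset_iff.2 h2) h1

/-- The submodule generated by `E_λ` depends only on the sizes of the blocks. -/
lemma charElt_stdChar_mem_span_of_perm (p : ℕ) [Fact p.Prime] [CharP F p] (hp : IsUnit (p : R))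
    (ψ : AddChar F Rˣ) {a b : Composition n} (hab : List.Perm a.blocks b.blocks) :
    charElt (stdChar ψ fun i j => a.index i = a.index j) ∈
      Submodule.span R[GL (Fin n) F] {charElt (stdChar ψ fun i j => b.index i = b.index j)} := by
  obtain ⟨w, hw, ho⟩ := exists_block_map hab
  refine charElt_stdChar_mem_span p hp ψ (b := fun i => (a.index i).val)
    (b' := fun i => (b.index i).val) (w := w) ?_ ?_ ?_ ?_ ?_ ?_
  · exact monotone_index a
  · exact monotone_index b
  · simpa only [Fin.val_inj] using hw
  · simpa only [Fin.val_inj] using ho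
  · intro i j _
    rw [Fin.val_inj]
  · intro i j _ _
    rw [Fin.val_inj]

end Inclusions

/-! ### The Bruhat decomposition -/

section Bruhat

variable {n : ℕ} {F : Type*} [Field F]

/-- `g` lies in `B W B`. -/
def InBruhat (g : GL (Fin n) F) : Prop :=
  ∃ b ∈ borel n F, ∃ σ : Equiv.Perm (Fin n), ∃ c ∈ borel n F, g = b * permGL n F σ * c

lemma InBruhat.borel_mul {b g : GL (Fin n) F} (hb : b ∈ borel n F) (hg : InBruhat g) :
    InBruhat (b * g) := by
  obtain ⟨b', hb', σ, c, hc, rfl⟩ := hg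
  exact ⟨b * b', mul_mem hb hb', σ, c, hc, by simp only [mul_assoc]⟩

lemma InBruhat.mul_borel {b g : GL (Fin n) F} (hb : b ∈ borel n F) (hg : InBruhat g) :
    InBruhat (g * b) := by
  obtain ⟨b', hb', σ, c, hc, rfl⟩ := hg
  exact ⟨b', hb', σ, c * b, mul_mem hc hb, by simp only [mul_assoc]⟩

lemma inBruhat_permGL (σ : Equiv.Perm (Fin n)) : InBruhat (permGL n F σ) :=
  ⟨1, one_mem _, σ, 1, one_mem _, by simp⟩

/-- If σ⁻¹ keeps i before j, then x(t) passes through σ into B on the right. Otherwise sσ has this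
property, and the rank one relation rewrites the product as x(t⁻¹) σ times an element of B. -/
lemma inBruhat_swap_mul_rootElt_mul {i j : Fin n} (h : i < j) (t : F) (σ : Equiv.Perm (Fin n)) :
    InBruhat (permGL n F (Equiv.swap i j) * (rootElt h t : GL (Fin n) F) * permGL n F σ) := by
  have hss := permGL_swap_mul_self (F := F) i j
  rcases lt_or_gt_of_ne (σ⁻¹.injective.ne h.ne) with hlt | hgt
  · refine ⟨1, one_mem _, Equiv.swap i j * σ, _, conj_mem_borel hlt (rootElt_support h t), ?_⟩
    rw [map_mul]
    group
  · by_cases ht : t = 0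
    · rw [ht, rootElt_zero, Subgroup.coe_one, mul_one, ← map_mul]
      exact inBruhat_permGL _
    · have hs : (Equiv.swap i j * σ)⁻¹ i < (Equiv.swap i j * σ)⁻¹ j := by
        simpa [mul_inv_rev] using hgt
      refine ⟨_, rootElt_mem_borel h t⁻¹, σ, _, conj_mem_borel hs (rankOneFactor_support h ht), ?_⟩
      have hrel := rankOne_relation h t
      rw [map_mul]
      generalize permGL n F (Equiv.swap i j) = s at *
      have hinv : s⁻¹ = s := inv_eq_of_mul_eq_one_right hss
      calc s * (rootElt h t : GL (Fin n) F) * permGL n F σ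
          = s * (rootElt h t : GL (Fin n) F) * s * (s * permGL n F σ) := by
            rw [← mul_assoc, mul_assoc _ s s, hss, mul_one]
        _ = _ := by
            rw [hrel, mul_inv_rev, hinv]
            group

lemma InBruhat.swap_mul {i j : Fin n} (hij : i.val + 1 = j.val) {g : GL (Fin n) F}
    (hg : InBruhat g) : InBruhat (permGL n F (Equiv.swap i j) * g) := by
  obtain ⟨b, hb, σ, c, hc, rfl⟩ := hg
  have h : i < j := by rw [Fin.lt_def]; omega
  have hss := permGL_swap_mul_self (F := F) i j
  have hdiag := borel_diag_ne_zero hb i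
  -- Chosen so that b x(-t) vanishes at the simple root and can be conjugated by s inside B.
  set t := (b : Matrix (Fin n) (Fin n) F) i j / (b : Matrix (Fin n) (Fin n) F) i i with ht
  set v : GL (Fin n) F := b * (rootElt h (-t) : GL (Fin n) F) with hv
  have hvB : v ∈ borel n F := mul_mem hb (rootElt_mem_borel h _)
  have hv0 : (v : Matrix (Fin n) (Fin n) F) i j = 0 := by
    rw [hv, Units.val_mul, rootElt_coe, Matrix.mul_transvection_apply_same, ht]
    field_simp
    ring
  have hb' : v * (rootElt h t : GL (Fin n) F) = b := by
    rw [hv, rootElt_neg, Subgroup.coe_inv, inv_mul_cancel_right]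
  have hrw : permGL n F (Equiv.swap i j) * (b * permGL n F σ * c) =
      permGL n F (Equiv.swap i j) * v * permGL n F (Equiv.swap i j) *
        (permGL n F (Equiv.swap i j) * (rootElt h t : GL (Fin n) F) * permGL n F σ * c) := by
    rw [← hb']
    generalize permGL n F (Equiv.swap i j) = s at *
    simp only [mul_assoc]
    rw [← mul_assoc s s, hss, one_mul]
  rw [hrw]
  exact ((inBruhat_swap_mul_rootElt_mul h t σ).mul_borel hc).borel_mul
    (conj_swap_mem_borel hij hvB hv0)

lemma InBruhat.permGL_mul (w : Equiv.Perm (Fin n)) {g : GL (Fin n) F} (hg : InBruhat g) :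
    InBruhat (permGL n F w * g) := by
  induction w using perm_adjacent_induction with
  | one => rwa [map_one, one_mul]
  | swap_mul i j σ hij ih =>
    rw [map_mul, mul_assoc]
    exact ih.swap_mul hij

/-- The Bruhat decomposition `GL_n(F) = B W B`. -/
lemma inBruhat (g : GL (Fin n) F) : InBruhat g := by
  -- Stability of BWB under left multiplication is the form that passes to products, so it can be
  -- checked on diagonal matrices and transvections.
  suffices H : ∀ M : Matrix (Fin n) (Fin n) F, M.det ≠ 0 → ∀ x : GL (Fin n) F, x.val = M →
      ∀ y : GL (Fin n) F, InBruhat y → InBruhat (x * y) by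
    have := H g.val ((Matrix.isUnit_iff_isUnit_det _).1 g.isUnit).ne_zero g rfl 1 (by simpa using inBruhat_permGL 1)
    rwa [mul_one] at this
  intro M hM
  refine Matrix.diagonal_transvection_induction_of_det_ne_zero
    (fun M => ∀ x : GL (Fin n) F, x.val = M → ∀ y, InBruhat y → InBruhat (x * y)) M hM ?_ ?_ ?_
  · intro D _ x hx y hy
    refine hy.borel_mul (mem_borel.2 fun i j hij => ?_)
    rw [hx] at hij
    by_contra hne
    exact hij (Matrix.diagonal_apply_ne _ fun h => hne h.le)
  · rintro ⟨i, j, hne, c⟩ x hx y hy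
    rw [Matrix.TransvectionStruct.toMatrix_mk] at hx
    rcases lt_or_gt_of_ne hne with h | h
    · have : x = (rootElt h c : GL (Fin n) F) := Units.ext hx
      rw [this]
      exact hy.borel_mul (rootElt_mem_borel h c)
    · have : x = permGL n F (Equiv.swap i j) * (rootElt h c : GL (Fin n) F) *
          (permGL n F (Equiv.swap i j))⁻¹ := by
        ext k l
        rw [hx, conj_permGL_apply, rootElt_coe, transvection_apply, transvection_apply,
          Equiv.swap_inv]
        have h1 : j = Equiv.swap i j k ↔ i = k := by
          rw [eq_comm, Equiv.swap_apply_eq_iff, Equiv.swap_apply_right, eq_comm]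
        have h2 : i = Equiv.swap i j l ↔ j = l := by
          rw [eq_comm, Equiv.swap_apply_eq_iff, Equiv.swap_apply_left, eq_comm]
        simp only [h1, h2, EmbeddingLike.apply_eq_iff_eq]
      rw [this, ← map_inv, mul_assoc, mul_assoc]
      exact ((hy.permGL_mul _).borel_mul (rootElt_mem_borel h c)).permGL_mul _
  · intro A B hA hB ihA ihB x hx y hy
    let a := Matrix.GeneralLinearGroup.mkOfDetNeZero A hA
    let b := Matrix.GeneralLinearGroup.mkOfDetNeZero B hB
    have : x = a * b := Units.ext hx
    rw [this, mul_assoc]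
    exact ihA a rfl _ (ihB b rfl _ hy)

end Bruhat

/-! ### Subgroups containing B -/

section Overgroups

variable {n : ℕ} {F : Type*} [Field F]

lemma exists_descent {σ : Equiv.Perm (Fin n)} (hσ : σ ≠ 1) :
    ∃ i j : Fin n, i.val + 1 = j.val ∧ σ j < σ i := by
  by_contra hno
  push Not at hno
  apply hσ
  rcases n with _ | n
  · exact Subsingleton.elim _ _
  · refine (Equiv.Perm.monotone_iff σ).1 (Fin.monotone_iff_le_succ.2 fun i => ?_)
    exact hno _ _ (by simp)

/-- The rearrangement inequality: the sum grows by σ i - σ j. It serves as a bounded measure in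
place of Coxeter length. -/
lemma sum_mul_swap_descent {σ : Equiv.Perm (Fin n)} {i j : Fin n} (hij : i.val + 1 = j.val)
    (h : σ j < σ i) :
    ∑ k : Fin n, (k.val : ℤ) * (σ k).val <
      ∑ k : Fin n, (k.val : ℤ) * ((σ * Equiv.swap i j) k).val := by
  have hne : i ≠ j := fun h => by rw [h] at hij; omega
  have key : ∑ k : Fin n, (k.val : ℤ) * ((σ * Equiv.swap i j) k).val =
      ∑ k : Fin n, ((k.val : ℤ) * (σ k).val + ((if k = i then ((σ k).val : ℤ) else 0) -
        if k = j then ((σ k).val : ℤ) else 0)) := by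
    rw [← Equiv.sum_comp (Equiv.swap i j)]
    refine Finset.sum_congr rfl fun k _ => ?_
    rw [Equiv.Perm.mul_apply, Equiv.swap_apply_self]
    by_cases hki : k = i
    · subst hki
      rw [Equiv.swap_apply_left, if_pos rfl, if_neg hne, ← hij]
      push_cast
      ring
    · by_cases hkj : k = j
      · subst hkj
        rw [Equiv.swap_apply_right, if_pos rfl, if_neg hki, ← hij]
        push_cast
        ring
      · rw [Equiv.swap_apply_of_ne_of_ne hki hkj, if_neg hki, if_neg hkj]
        ring
  rw [key, Finset.sum_add_distrib, Finset.sum_sub_distrib, Finset.sum_ite_eq', Finset.sum_ite_eq',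
    if_pos (Finset.mem_univ _), if_pos (Finset.mem_univ _)]
  rw [Fin.lt_def] at h
  omega

lemma sum_mul_perm_le (σ : Equiv.Perm (Fin n)) :
    ∑ k : Fin n, (k.val : ℤ) * (σ k).val ≤ n * (n * n) := by
  refine (Finset.sum_le_card_nsmul Finset.univ _ ((n : ℤ) * n) fun k _ => ?_).trans ?_
  · have h1 := k.2
    have h2 := (σ k).2
    gcongr
  · simp

/-- If a permutation in an overgroup of `B` inverts the order of `i` and `j`, then the transposition
of `i` and `j` lies in the overgroup as well. -/
lemma swap_mem_of_descent {P : Subgroup (GL (Fin n) F)} (hP : borel n F ≤ P)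
    {σ : Equiv.Perm (Fin n)} (hσ : permGL n F σ ∈ P) {i j : Fin n} (h : i < j)
    (hdesc : σ j < σ i) : permGL n F (Equiv.swap i j) ∈ P := by
  have hss := permGL_swap_mul_self (F := F) i j
  have h1 : (Equiv.swap i j * σ⁻¹)⁻¹ i < (Equiv.swap i j * σ⁻¹)⁻¹ j := by
    simpa [mul_inv_rev] using hdesc
  -- This puts σ s x(1) s σ⁻¹ in B. Hence s x(1) s ∈ P, and the rank one relation isolates s.
  have h2 := hP (conj_mem_borel h1 (rootElt_support (F := F) h 1))
  have h3 : permGL n F (Equiv.swap i j) * (rootElt h (1 : F) : GL (Fin n) F) *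
      permGL n F (Equiv.swap i j) ∈ P := by
    have := mul_mem (mul_mem (inv_mem hσ) h2) hσ
    rw [map_mul, map_inv] at this
    have hinv : (permGL n F (Equiv.swap i j))⁻¹ = permGL n F (Equiv.swap i j) :=
      inv_eq_of_mul_eq_one_right hss
    convert this using 1
    rw [mul_inv_rev, hinv]
    group
  rw [rankOne_relation] at h3
  have h4 := hP (rootElt_mem_borel h (1 : F)⁻¹)
  have h5 := hP (rankOneFactor_mem_borel h (one_ne_zero (α := F)))
  rwa [Subgroup.mul_mem_cancel_right _ h5, Subgroup.mul_mem_cancel_left _ h4] at h3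

lemma permGL_mem_of_mem {P Q : Subgroup (GL (Fin n) F)} (hP : borel n F ≤ P)
    (hQ : ∀ i j : Fin n, i.val + 1 = j.val → permGL n F (Equiv.swap i j) ∈ P →
      permGL n F (Equiv.swap i j) ∈ Q) (σ : Equiv.Perm (Fin n)) (hσ : permGL n F σ ∈ P) :
    permGL n F σ ∈ Q := by
  obtain ⟨N, hN⟩ : ∃ N : ℕ, N = ((n : ℤ) * (n * n) - ∑ k : Fin n, (k.val : ℤ) * (σ k).val).toNat :=
    ⟨_, rfl⟩
  induction N using Nat.strong_induction_on generalizing σ with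
  | _ N ih =>
    by_cases h1 : σ = 1
    · rw [h1, map_one]
      exact one_mem _
    · obtain ⟨i, j, hij, hdesc⟩ := exists_descent h1
      have hlt : i < j := by rw [Fin.lt_def]; omega
      have hs := swap_mem_of_descent hP hσ hlt hdesc
      have hmem : permGL n F (σ * Equiv.swap i j) ∈ P := by
        rw [map_mul]
        exact mul_mem hσ hs
      have hlt' := sum_mul_swap_descent hij hdesc
      have hle := sum_mul_perm_le σ
      have hle' := sum_mul_perm_le (σ * Equiv.swap i j)
      have := ih _ (by omega) _ hmem rfl
      rwa [map_mul, Subgroup.mul_mem_cancel_right _ (hQ i j hij hs)] at this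

/-- A standard parabolic subgroup is generated by `B` and its fundamental transpositions. -/
lemma parabolicOf_eq {P : Subgroup (GL (Fin n) F)} (hP : borel n F ≤ P) :
    parabolicOf F {s | ∃ i j : Fin n, i.val + 1 = j.val ∧ s = Equiv.swap i j ∧
      permGL n F s ∈ P} = P := by
  apply le_antisymm
  · refine sup_le hP ((Subgroup.closure_le _).2 ?_)
    rintro _ ⟨s, ⟨i, j, _, _, hs⟩, rfl⟩
    exact hs
  · intro g hg
    obtain ⟨b, hb, σ, c, hc, rfl⟩ := inBruhat g
    have hσ : permGL n F σ ∈ P := by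
      rwa [Subgroup.mul_mem_cancel_right _ (hP hc), Subgroup.mul_mem_cancel_left _ (hP hb)] at hg
    refine mul_mem (mul_mem (le_sup_left (α := Subgroup _) hb) ?_) (le_sup_left (α := Subgroup _) hc)
    refine permGL_mem_of_mem hP (fun i j hij hs => ?_) σ hσ
    exact le_sup_right (α := Subgroup _)
      (Subgroup.subset_closure ⟨_, ⟨i, j, hij, rfl, hs⟩, rfl⟩)

lemma permGL_swap_mem_blockUpper_iff {b : Fin n → ℕ} (i j : Fin n) :
    permGL n F (Equiv.swap i j) ∈ blockUpper F b ↔ b i = b j := by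
  constructor
  · intro h
    have := label_of_mul_permGL_mem (u := 1) (F := F) (b := b) (σ := Equiv.swap i j) (by simp)
      (by rwa [one_mul]) j
    rwa [Equiv.swap_apply_right] at this
  · intro h
    refine permGL_mem_blockUpper fun k => ?_
    rw [Equiv.swap_apply_def]
    split_ifs with h1 h2
    · rw [h1, h]
    · rw [h2, h]
    · rfl

lemma swap_adjacent_injective {i j i' j' : Fin n} (h : i.val + 1 = j.val) (h' : i'.val + 1 = j'.val)
    (heq : Equiv.swap i j = Equiv.swap i' j') : i = i' ∧ j = j' := by
  have h1 := congrArg (fun σ : Equiv.Perm (Fin n) => σ i) heq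
  simp only [Equiv.swap_apply_left, Equiv.swap_apply_def] at h1
  split_ifs at h1 with h2 h3 <;> simp only [Fin.ext_iff] at * <;> omega

lemma swap_mem_parabolicOf {J : Set (Equiv.Perm (Fin n))}
    (hJ : ∀ s ∈ J, ∃ i j : Fin n, i.val + 1 = j.val ∧ s = Equiv.swap i j) {i j : Fin n}
    (hij : i.val + 1 = j.val) (h : permGL n F (Equiv.swap i j) ∈ parabolicOf F J) :
    Equiv.swap i j ∈ J := by
  by_contra hnot
  -- The maximal parabolic cut after i contains B and all of J, but not the transposition of i and
  -- j.
  let b : Fin n → ℕ := fun k => if k ≤ i then 0 else 1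
  have hb : Monotone b := by
    intro k l hkl
    simp only [b]
    split_ifs with h1 h2
    · rfl
    · exact Nat.zero_le _
    · exact absurd (hkl.trans ‹_›) h1
    · rfl
  have hle : parabolicOf F J ≤ blockUpper F b := by
    refine sup_le (borel_le_blockUpper hb) ((Subgroup.closure_le _).2 ?_)
    rintro _ ⟨s, hs, rfl⟩
    obtain ⟨k, l, hkl, rfl⟩ := hJ s hs
    refine (permGL_swap_mem_blockUpper_iff k l).2 ?_
    have hki : k ≠ i := by
      rintro rfl
      have : l = j := Fin.ext (by omega)
      rw [this] at hs
      exact hnot hs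
    simp only [b, Fin.le_def]
    have : k.val ≠ i.val := fun h => hki (Fin.ext h)
    split_ifs <;> omega
  have := (permGL_swap_mem_blockUpper_iff i j).1 (hle h)
  simp only [b, Fin.le_def] at this
  rw [if_pos le_rfl, if_neg (by omega)] at this
  omega

end Overgroups

/-! ### The parabolic subgroup of a character -/

section ParabolicCharacters

variable {n : ℕ} {F : Type*} [Field F] {R : Type*} [CommRing R]

lemma swap_mem_charParabolic_iff (lam : unitri n F →* Rˣ) {i j : Fin n} (h : i < j)
    (hij : i.val + 1 = j.val) :
    permGL n F (Equiv.swap i j) ∈ charParabolic lam ↔ ∃ a : F, lam (rootElt h a) ≠ 1 := by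
  constructor
  · intro hmem
    obtain ⟨i', j', h', hij', heq, ha⟩ := swap_mem_parabolicOf (J := charSupport lam)
      (fun s ⟨i, j, _, hij, hs, _⟩ => ⟨i, j, hij, hs⟩) hij hmem
    obtain ⟨rfl, rfl⟩ := swap_adjacent_injective hij hij' heq
    exact ha
  · intro ha
    exact le_sup_right (α := Subgroup _)
      (Subgroup.subset_closure ⟨_, ⟨i, j, h, hij, rfl, ha⟩, rfl⟩)

/-- The simple roots of a parabolic subgroup. -/
def simpleRoots (P : Subgroup (GL (Fin n) F)) (i j : Fin n) : Prop :=
  permGL n F (Equiv.swap i j) ∈ P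

/-- As ψ is nontrivial, the support consists of exactly the fundamental transpositions in P, and
with B these generate P. -/
lemma charParabolic_stdChar {ψ : AddChar F Rˣ} (hψ : ψ ≠ 1) {P : Subgroup (GL (Fin n) F)}
    (hP : borel n F ≤ P) : charParabolic (stdChar ψ (simpleRoots P)) = P := by
  conv_rhs => rw [← parabolicOf_eq hP]
  rw [charParabolic]
  congr 1
  ext s
  constructor
  · rintro ⟨i, j, h, hij, rfl, a, ha⟩
    rw [stdChar_rootElt ψ _ h hij] at ha
    refine ⟨i, j, hij, rfl, ?_⟩
    by_contra hnot
    exact ha (if_neg hnot)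
  · rintro ⟨i, j, hij, rfl, hs⟩
    have h : i < j := by rw [Fin.lt_def]; omega
    obtain ⟨a, ha⟩ := AddChar.ne_one_iff.1 hψ
    refine ⟨i, j, h, hij, rfl, a, ?_⟩
    rwa [stdChar_rootElt ψ _ h hij, if_pos (show simpleRoots P i j from hs)]

end ParabolicCharacters

/-! ### Simple root subgroups determine characters of U -/

section Generation

variable {n : ℕ} {F : Type*} [Field F]

lemma rootElt_commutator {i k j : Fin n} (hik : i < k) (hkj : k < j) (a : F) :
    rootElt hik a * rootElt hkj 1 =
      rootElt (hik.trans hkj) a * (rootElt hkj 1 * rootElt hik a) := by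
  ext1; ext1
  have hij := hik.trans hkj
  have h1 : Matrix.single i j a * Matrix.single k j (1 : F) = 0 :=
    Matrix.single_mul_single_of_ne (h := hkj.ne') ..
  have h2 : Matrix.single i j a * Matrix.single i k a = 0 :=
    Matrix.single_mul_single_of_ne (h := hij.ne') ..
  have h3 : Matrix.single k j (1 : F) * Matrix.single i k a = 0 :=
    Matrix.single_mul_single_of_ne (h := hij.ne') ..
  simp only [Subgroup.coe_mul, Units.val_mul, rootElt_coe, Matrix.transvection, mul_add, add_mul,
    mul_one, one_mul, Matrix.single_mul_single_same, h1, h2, h3, mul_zero]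
  abel

variable {A : Type*} [CommGroup A]

/-- A root element that is not simple is a commutator, which dies in an abelian group. -/
lemma map_rootElt_eq_one {f : unitri n F →* A}
    (hf : ∀ (i j : Fin n) (h : i < j), i.val + 1 = j.val → ∀ a : F, f (rootElt h a) = 1)
    {i j : Fin n} (h : i < j) (a : F) : f (rootElt h a) = 1 := by
  by_cases hij : i.val + 1 = j.val
  · exact hf i j h hij a
  · have hlt : i.val + 1 < n := by have := j.2; rw [Fin.lt_def] at h; omega
    let k : Fin n := ⟨i.val + 1, hlt⟩
    have hik : i < k := by rw [Fin.lt_def]; simp [k]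
    have hkj : k < j := by rw [Fin.lt_def] at *; simp only [k]; omega
    have := congrArg f (rootElt_commutator hik hkj a)
    rw [map_mul, map_mul, map_mul, mul_comm (f (rootElt hik a))] at this
    exact right_eq_mul.1 this

/-- A homomorphism from `U` to an abelian group that kills the simple root subgroups is trivial. -/
lemma map_unitri_eq_one {f : unitri n F →* A}
    (hf : ∀ (i j : Fin n) (h : i < j), i.val + 1 = j.val → ∀ a : F, f (rootElt h a) = 1)
    (u : unitri n F) : f u = 1 := by
  classical
  let S : unitri n F → Finset (Fin n × Fin n) := fun u =>
    Finset.univ.filter fun x => x.1 ≠ x.2 ∧ (u : GL (Fin n) F).val x.1 x.2 ≠ 0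
  obtain ⟨N, hN⟩ : ∃ N, N = (S u).card := ⟨_, rfl⟩
  induction N using Nat.strong_induction_on generalizing u with
  | _ N ih =>
    rcases (S u).eq_empty_or_nonempty with hemp | hne
    · have : u = 1 := by
        ext i j
        rw [Subgroup.coe_one, Units.val_one]
        by_cases hij : i = j
        · rw [hij, u.2.2, Matrix.one_apply_eq]
        · rw [Matrix.one_apply_ne hij]
          by_contra h0
          have : (i, j) ∈ S u := by simp [S, hij, h0]
          rw [hemp] at this
          simp at this
      rw [this, map_one]
    · obtain ⟨⟨i, k⟩, hmem, hmax⟩ := Finset.exists_max_image (S u) (fun x => x.2) hne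
      simp only [S, Finset.mem_filter, Finset.mem_univ, true_and] at hmem
      have hik : i < k := lt_of_le_of_ne (mem_borel.1 u.2.1 i k hmem.2) hmem.1
      have hrow : ∀ l, l ≠ k → (u : GL (Fin n) F).val k l = 0 := by
        intro l hl
        by_contra h0
        have h1 := mem_borel.1 u.2.1 k l h0
        have h2 := hmax (k, l) (by simp [S, Ne.symm hl, h0])
        exact hl (le_antisymm h2 h1)
      set v : unitri n F := rootElt hik (-(u : GL (Fin n) F).val i k) * u with hv
      have hvi : ∀ l, (v : GL (Fin n) F).val i l = if l = k then 0 else (u : GL (Fin n) F).val i l := by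
        intro l
        rw [hv, Subgroup.coe_mul, Units.val_mul, rootElt_coe, Matrix.transvection_mul_apply_same]
        split_ifs with hl
        · rw [hl, u.2.2]
          ring
        · rw [hrow l hl]
          ring
      have hvne : ∀ m l, m ≠ i → (v : GL (Fin n) F).val m l = (u : GL (Fin n) F).val m l := by
        intro m l hm
        rw [hv, Subgroup.coe_mul, Units.val_mul, rootElt_coe,
          Matrix.transvection_mul_apply_of_ne _ _ _ _ hm]
      have hlt : (S v).card < (S u).card := by
        refine Finset.card_lt_card ((Finset.ssubset_iff_of_subset ?_).2 ⟨(i, k), ?_, ?_⟩)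
        · rintro ⟨m, l⟩ hml
          simp only [S, Finset.mem_filter, Finset.mem_univ, true_and] at hml ⊢
          refine ⟨hml.1, fun h0 => hml.2 ?_⟩
          by_cases hm : m = i
          · rw [hm] at h0 ⊢
            rw [hvi, h0, ite_self]
          · rw [hvne m l hm, h0]
        · simp only [S, Finset.mem_filter, Finset.mem_univ, true_and]
          exact hmem
        · simp [S, hvi]
      have h1 := ih _ (hN ▸ hlt) v rfl
      rwa [hv, map_mul, map_rootElt_eq_one hf, one_mul] at h1

lemma unitri_hom_ext {f g : unitri n F →* A}
    (hfg : ∀ (i j : Fin n) (h : i < j), i.val + 1 = j.val → ∀ a : F,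
      f (rootElt h a) = g (rootElt h a)) : f = g := by
  ext u
  have := map_unitri_eq_one (f := f / g) (fun i j hij hadj a => by
    rw [MonoidHom.div_apply, hfg i j hij hadj a, div_self']) u
  rwa [MonoidHom.div_apply, div_eq_one] at this

end Generation

/-! ### Additive characters of F with values in R -/

section AdditiveCharacters

variable {F : Type*} [Field F] [Fintype F] {R : Type*} [CommRing R]

lemma exists_addChar_ne_one (p : ℕ) [Fact p.Prime] [CharP F p]
    (hζ : ∃ ζ : R, IsPrimitiveRoot ζ p) : ∃ ψ : AddChar F Rˣ, ψ ≠ 1 := by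
  obtain rfl : ringChar F = p := ringChar.eq F p
  obtain ⟨ζ, hζ⟩ := hζ
  have hp : (ringChar F).Prime := Fact.out
  obtain ⟨z, rfl⟩ := hζ.isUnit hp.ne_zero
  have hz : IsPrimitiveRoot z (ringChar F) := IsPrimitiveRoot.coe_units_iff.1 hζ
  let : Algebra (ZMod (ringChar F)) F := ZMod.algebra _ _
  obtain ⟨a, ha⟩ := FiniteField.trace_to_zmod_nondegenerate F (one_ne_zero (α := F))
  rw [one_mul] at ha
  -- The character a ↦ ζ^(Tr a), nontrivial because the trace form is nondegenerate.
  refine ⟨(AddChar.zmodChar (ringChar F) hz.pow_eq_one).compAddMonoidHom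
    (Algebra.trace (ZMod (ringChar F)) F).toAddMonoidHom, AddChar.ne_one_iff.2 ⟨a, fun h => ha ?_⟩⟩
  have h' : z ^ (Algebra.trace (ZMod (ringChar F)) F a).val = 1 := h
  rw [hz.pow_eq_one_iff_dvd] at h'
  rw [← ZMod.val_eq_zero]
  exact Nat.eq_zero_of_dvd_of_lt h' (ZMod.val_lt _)

/-- Every additive character of a finite field is a multiplicative shift of a given nontrivial
one. -/
lemma exists_mulShift_eq [IsDomain R] {ψ : AddChar F Rˣ} (hψ : ψ ≠ 1) (χ : AddChar F Rˣ) :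
    ∃ a : F, ∀ x, χ x = ψ (a * x) := by
  classical
  by_contra! hno
  let toHom : AddChar F Rˣ → (Multiplicative F →* R) := fun χ => (Units.coeHom R).comp χ.toMonoidHom
  have hval : ∀ (χ : AddChar F Rˣ) (x : F), toHom χ (Multiplicative.ofAdd x) = (χ x : Rˣ) :=
    fun _ _ => rfl
  have hshift : ∀ (a x : F), (ψ.compAddMonoidHom (AddMonoidHom.mulLeft a)) x = ψ (a * x) :=
    fun _ _ => rfl
  -- If χ is not a shift, then χ and the q shifts of ψ are q + 1 distinct characters, independent by
  -- Dedekind in a space of rank q.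
  let f : Option F → (Multiplicative F →* R) := fun o =>
    o.elim (toHom χ) fun a => toHom (ψ.compAddMonoidHom (AddMonoidHom.mulLeft a))
  have hinj : Function.Injective f := by
    have heq : ∀ χ₁ χ₂ : AddChar F Rˣ, toHom χ₁ = toHom χ₂ → ∀ x, χ₁ x = χ₂ x := fun χ₁ χ₂ h x =>
      Units.ext (by rw [← hval, ← hval, h])
    rintro (_ | a) (_ | b) hab
    · rfl
    · obtain ⟨x, hx⟩ := hno b
      exact absurd (heq _ _ hab x) hx
    · obtain ⟨x, hx⟩ := hno a
      exact absurd (heq _ _ hab.symm x) hx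
    · by_contra hne
      have hne' : a - b ≠ 0 := fun h => hne (congrArg some (sub_eq_zero.1 h))
      obtain ⟨x, hx⟩ := AddChar.ne_one_iff.1 hψ
      have := heq _ _ hab ((a - b)⁻¹ * x)
      rw [hshift, hshift] at this
      apply hx
      have hx' : x = a * ((a - b)⁻¹ * x) - b * ((a - b)⁻¹ * x) := by
        field_simp
      rw [hx', AddChar.map_sub_eq_div, this, div_self']
  have hli := (linearIndependent_monoidHom (Multiplicative F) R).comp f hinj
  have hcard := hli.fintype_card_le_finrank
  rw [Module.finrank_fintype_fun_eq_card, Fintype.card_option, Fintype.card_multiplicative] at hcard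
  omega

end AdditiveCharacters

/-! ### The action of diagonal matrices on characters -/

section Torus

variable {n : ℕ} {F : Type*} [Field F]

/-- The diagonal matrix with the given entries. -/
def torusElt (d : Fin n → Fˣ) : GL (Fin n) F where
  val := Matrix.diagonal fun i => (d i : F)
  inv := Matrix.diagonal fun i => ((d i)⁻¹ : Fˣ).val
  val_inv := by rw [Matrix.diagonal_mul_diagonal]; simp
  inv_val := by rw [Matrix.diagonal_mul_diagonal]; simp

lemma conj_torusElt_apply (d : Fin n → Fˣ) (g : GL (Fin n) F) (i j : Fin n) :
    (torusElt d * g * (torusElt d)⁻¹).val i j = d i * g.val i j * ((d j)⁻¹ : Fˣ).val := by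
  change ((Matrix.diagonal fun i => (d i : F)) * g.val *
    Matrix.diagonal fun i => ((d i)⁻¹ : Fˣ).val) i j = _
  rw [Matrix.mul_diagonal, Matrix.diagonal_mul]

/-- Conjugation by a diagonal matrix as an endomorphism of `U`. -/
def torusConj (d : Fin n → Fˣ) : unitri n F →* unitri n F where
  toFun u := ⟨torusElt d * u * (torusElt d)⁻¹, mem_borel.2 fun i j hij => by
      rw [conj_torusElt_apply] at hij
      exact mem_borel.1 u.2.1 i j (right_ne_zero_of_mul (left_ne_zero_of_mul hij)),
    fun i => by rw [conj_torusElt_apply, u.2.2]; simp⟩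
  map_one' := by ext1; simp
  map_mul' u v := by
    ext1
    simp only [Subgroup.coe_mul]
    group

lemma coe_torusConj (d : Fin n → Fˣ) (u : unitri n F) :
    (torusConj d u : GL (Fin n) F) = torusElt d * u * (torusElt d)⁻¹ := rfl

lemma torusConj_rootElt (d : Fin n → Fˣ) {i j : Fin n} (h : i < j) (a : F) :
    torusConj d (rootElt h a) = rootElt h (d i * a * ((d j)⁻¹ : Fˣ).val) := by
  ext k l
  rw [coe_torusConj, conj_torusElt_apply, rootElt_coe, rootElt_coe, transvection_apply,
    transvection_apply]
  by_cases hkl : k = l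
  · subst hkl
    have : ¬ (i = k ∧ j = k) := fun h' => h.ne (h'.1.trans h'.2.symm)
    simp [this]
  · rw [if_neg hkl, zero_add, zero_add]
    split_ifs with h'
    · rw [h'.1, h'.2]
    · simp

variable [Fintype F] {R : Type*} [CommRing R]

open MonoidAlgebra (of)

lemma torusElt_mul_charOp (d : Fin n → Fˣ) (lam : unitri n F →* Rˣ) :
    of R (GL (Fin n) F) (torusElt d) * charOp (lam.comp (torusConj d)) =
      charOp lam * of R (GL (Fin n) F) (torusElt d) := by
  classical
  rw [charOp, charOp, Finset.mul_sum, Finset.sum_mul]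
  have hinj : Function.Injective (torusConj d) := fun u v huv => by
    have := congrArg (Subtype.val) huv
    rw [coe_torusConj, coe_torusConj] at this
    exact Subtype.ext (mul_left_cancel (mul_right_cancel this))
  refine Fintype.sum_bijective _ (Finite.injective_iff_bijective.1 hinj) _ _ fun u => ?_
  rw [MonoidAlgebra.of_apply, MonoidAlgebra.single_mul_single, MonoidAlgebra.single_mul_single,
    coe_torusConj, inv_mul_cancel_right, one_mul, mul_one]
  rfl

/-- Diagonal matrices normalize U and fix e, so translating by one only twists the character;
conjugate characters generate the same submodule. -/
lemma torusElt_smul_charElt (d : Fin n → Fˣ) (lam : unitri n F →* Rˣ) :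
    of R (GL (Fin n) F) (torusElt d) • charElt (lam.comp (torusConj d)) = charElt lam := by
  ext1
  rw [Submodule.coe_smul, smul_eq_mul, coe_charElt, coe_charElt, ← mul_assoc, torusElt_mul_charOp,
    mul_assoc, diagonal_mul_steinbergElt]
  intro a b hab
  by_contra hne
  exact hab (Matrix.diagonal_apply_ne _ hne)

lemma span_of_smul (g : GL (Fin n) F) (x : lattice n F R) :
    Submodule.span R[GL (Fin n) F] {of R (GL (Fin n) F) g • x} =
      Submodule.span R[GL (Fin n) F] {x} := by
  apply le_antisymm
  · rw [Submodule.span_singleton_le_iff_mem]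
    exact Submodule.smul_mem _ _ (Submodule.mem_span_singleton_self x)
  · rw [Submodule.span_singleton_le_iff_mem]
    have := Submodule.smul_mem (Submodule.span R[GL (Fin n) F] {of R (GL (Fin n) F) g • x})
      (of R (GL (Fin n) F) g⁻¹) (Submodule.mem_span_singleton_self _)
    rwa [smul_smul, ← map_mul, inv_mul_cancel, map_one, one_smul] at this

/-- Up to conjugation by the torus a character of `U` is determined by its simple roots. -/
lemma exists_torusConj_eq [IsDomain R] {ψ : AddChar F Rˣ} (hψ : ψ ≠ 1) (lam : unitri n F →* Rˣ)
    {J : Fin n → Fin n → Prop} (hJ : ∀ (i j : Fin n) (h : i < j), i.val + 1 = j.val →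
      (J i j ↔ ∃ a : F, lam (rootElt h a) ≠ 1)) :
    ∃ d : Fin n → Fˣ, lam = (stdChar ψ J).comp (torusConj d) := by
  classical
  have hα : ∀ i : Fin n, ∃ α : Fˣ, ∀ (j : Fin n) (h : i < j), i.val + 1 = j.val → J i j →
      ∀ a : F, lam (rootElt h a) = ψ (α * a) := by
    intro i
    by_cases hj : ∃ (j : Fin n) (h : i < j), i.val + 1 = j.val ∧ J i j
    · obtain ⟨j, h, hij, hJij⟩ := hj
      let χ : AddChar F Rˣ :=
        { toFun := fun a => lam (rootElt h a)
          map_zero_eq_one' := by rw [rootElt_zero, map_one]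
          map_add_eq_mul' := fun a b => by rw [rootElt_add, map_mul] }
      obtain ⟨a, ha⟩ := exists_mulShift_eq hψ χ
      have ha0 : a ≠ 0 := by
        rintro rfl
        obtain ⟨x, hx⟩ := (hJ i j h hij).1 hJij
        have := ha x
        rw [zero_mul, AddChar.map_zero_eq_one] at this
        exact hx this
      refine ⟨Units.mk0 a ha0, fun j' h' hij' _ x => ?_⟩
      obtain rfl : j = j' := Fin.ext (by omega)
      exact ha x
    · exact ⟨1, fun j h hij hJij => absurd ⟨j, h, hij, hJij⟩ hj⟩
  choose α hα using hα
  -- A telescoping choice: d_i / d_(i+1) = α_i, the scalar by which conjugation acts on the simple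
  -- root subgroup.
  refine ⟨fun k => ∏ m ∈ Finset.univ.filter (· < k), (α m)⁻¹, unitri_hom_ext fun i j h hij a => ?_⟩
  rw [MonoidHom.comp_apply, torusConj_rootElt, stdChar_rootElt ψ J h hij]
  split_ifs with hJij
  · rw [hα i j h hij hJij a]
    congr 1
    have hfilter : Finset.univ.filter (· < j) = insert i (Finset.univ.filter (· < i)) := by
      ext m
      simp only [Finset.mem_filter, Finset.mem_univ, true_and, Finset.mem_insert, Fin.lt_def,
        Fin.ext_iff]
      omega
    rw [hfilter, Finset.prod_insert (by simp), mul_right_comm, ← Units.val_mul, mul_inv_rev,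
      mul_inv_cancel_left, inv_inv]
  · by_contra hne
    exact hJij ((hJ i j h hij).2 ⟨a, hne⟩)

end Torus

/-! ### The submodules I'(P) and L'(P) -/

section Submodules

lemma ParabolicEquiv.symm {n : ℕ} {F : Type*} [Field F] {P Q : Subgroup (GL (Fin n) F)}
    (h : ParabolicEquiv P Q) : ParabolicEquiv Q P := by
  obtain ⟨a, b, ha, hb, hab⟩ := h
  exact ⟨b, a, hb, ha, hab.symm⟩

lemma simpleRoots_compParabolic {n : ℕ} {F : Type*} [Field F] (c : Composition n) (i j : Fin n) :
    simpleRoots (compParabolic F c) i j ↔ c.index i = c.index j := by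
  have : compParabolic F c = blockUpper F fun k => (c.index k).val := by
    ext g
    rw [compParabolic, mem_blockUpper, mem_blockUpper]
    rfl
  rw [simpleRoots, this, permGL_swap_mem_blockUpper_iff, Fin.val_inj]

variable {n : ℕ} {F : Type*} [Field F] [Fintype F] {R : Type*} [CommRing R]

lemma span_charElt_eq [IsDomain R] {ψ : AddChar F Rˣ} (hψ : ψ ≠ 1)
    {P : Subgroup (GL (Fin n) F)} {lam : unitri n F →* Rˣ} (hlam : charParabolic lam = P) :
    Submodule.span R[GL (Fin n) F] {charElt lam} =
      Submodule.span R[GL (Fin n) F] {charElt (stdChar ψ (simpleRoots P))} := by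
  obtain ⟨d, hd⟩ := exists_torusConj_eq hψ lam (J := simpleRoots P) fun i j h hij => by
    rw [← swap_mem_charParabolic_iff lam h hij, hlam, simpleRoots]
  rw [← torusElt_smul_charElt d (stdChar ψ (simpleRoots P)), ← hd, span_of_smul]

lemma IPrime_eq_span_stdChar [IsDomain R] {ψ : AddChar F Rˣ} (hψ : ψ ≠ 1)
    {P : Subgroup (GL (Fin n) F)} (hP : IsStandardParabolic P) :
    IPrime R P = Submodule.span R[GL (Fin n) F] {charElt (stdChar ψ (simpleRoots P))} := by
  apply le_antisymm
  · refine Submodule.span_le.2 ?_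
    rintro _ ⟨lam, hlam, rfl⟩
    rw [SetLike.mem_coe, ← span_charElt_eq hψ hlam]
    exact Submodule.mem_span_singleton_self _
  · rw [Submodule.span_singleton_le_iff_mem]
    exact Submodule.subset_span ⟨_, charParabolic_stdChar hψ hP, rfl⟩

lemma LPrime_eq_span {ℓ : ℕ} {P : Subgroup (GL (Fin n) F)} {x : lattice n F R}
    (h : IPrime R P = Submodule.span R[GL (Fin n) F] {x}) :
    LPrime R ℓ P = Submodule.span (Residue R ℓ)[GL (Fin n) F] {(ellLattice n F R ℓ).mkQ x} := by
  apply le_antisymm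
  · rintro _ ⟨y, hy, rfl⟩
    rw [SetLike.mem_coe, h, Submodule.mem_span_singleton] at hy
    obtain ⟨r, rfl⟩ := hy
    rw [map_smul, ← redHom_smul]
    exact Submodule.smul_mem _ _ (Submodule.mem_span_singleton_self _)
  · rw [Submodule.span_singleton_le_iff_mem]
    exact ⟨x, h ▸ Submodule.mem_span_singleton_self x, rfl⟩

lemma LPrime_mono {ℓ : ℕ} {P Q : Subgroup (GL (Fin n) F)} (h : IPrime R Q ≤ IPrime R P) :
    LPrime R ℓ Q ≤ LPrime R ℓ P :=
  fun _ hm => Submodule.map_mono h hm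

variable [IsDomain R] [CharZero R]

lemma IPrime_mono (p : ℕ) [Fact p.Prime] [CharP F p] (hp : IsUnit (p : R)) {ψ : AddChar F Rˣ}
    (hψ : ψ ≠ 1) {P Q : Subgroup (GL (Fin n) F)} (hP : IsStandardParabolic P)
    (hQ : IsStandardParabolic Q) (h : Q ≤ P) : IPrime R Q ≤ IPrime R P := by
  rw [IPrime_eq_span_stdChar hψ hP, IPrime_eq_span_stdChar hψ hQ,
    Submodule.span_singleton_le_iff_mem]
  exact charElt_stdChar_mem_span_of_le p hp ψ fun i j _ hij => h hij

lemma IPrime_le_of_equiv (p : ℕ) [Fact p.Prime] [CharP F p] (hp : IsUnit (p : R))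
    {ψ : AddChar F Rˣ} (hψ : ψ ≠ 1) {P Q : Subgroup (GL (Fin n) F)} (hP : IsStandardParabolic P)
    (hQ : IsStandardParabolic Q) (h : ParabolicEquiv Q P) : IPrime R Q ≤ IPrime R P := by
  rw [IPrime_eq_span_stdChar hψ hP, IPrime_eq_span_stdChar hψ hQ,
    Submodule.span_singleton_le_iff_mem]
  obtain ⟨a, b, rfl, rfl, hab⟩ := h
  rw [stdChar_congr ψ fun i j _ => simpleRoots_compParabolic a i j,
    stdChar_congr ψ fun i j _ => simpleRoots_compParabolic b i j]
  exact charElt_stdChar_mem_span_of_perm p hp ψ hab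

end Submodules

/-- Otherwise the maximal ideal contains the coprime integers p and ℓ, hence 1. -/
lemma isUnit_natCast_of_maximalIdeal_eq {R : Type*} [CommRing R] [IsLocalRing R] {p ℓ : ℕ}
    (hp : p.Prime) (hℓ : ℓ.Prime) (hne : ℓ ≠ p)
    (hmax : IsLocalRing.maximalIdeal R = Ideal.span {(ℓ : R)}) : IsUnit (p : R) := by
  by_contra h
  have h1 : (p : R) ∈ IsLocalRing.maximalIdeal R := (IsLocalRing.mem_maximalIdeal _).2 h
  have h2 : (ℓ : R) ∈ IsLocalRing.maximalIdeal R := hmax ▸ Ideal.mem_span_singleton_self _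
  have hcop : IsCoprime (ℓ : R) (p : R) :=
    ((Nat.coprime_primes hℓ hp).2 hne).cast
  obtain ⟨a, b, hab⟩ := hcop
  refine (Ideal.ne_top_iff_one _).1 (IsLocalRing.maximalIdeal.isMaximal R).ne_top ?_
  rw [← hab]
  exact add_mem (Ideal.mul_mem_left _ a h2) (Ideal.mul_mem_left _ b h1)

end Steinberg

theorem mainTheorem3
    (n : ℕ) (hn : 2 ≤ n) (p ℓ : ℕ) [Fact p.Prime] [Fact ℓ.Prime] (hℓp : ℓ ≠ p)
    (F : Type*) [Field F] [Fintype F] [CharP F p]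
    (R : Type*) [CommRing R] [IsDomain R] [IsPrincipalIdealRing R] [IsLocalRing R] [CharZero R]
    (hmax : IsLocalRing.maximalIdeal R = Ideal.span {(ℓ : R)})
    (hζ : ∃ ζ : R, IsPrimitiveRoot ζ p) :
    -- `I'(P)` and `L'(P)` are well defined
    (∀ P : Subgroup (GL (Fin n) F), Steinberg.IsStandardParabolic P →
      (∃ lam : Steinberg.unitri n F →* Rˣ, Steinberg.charParabolic lam = P) ∧
      ∀ lam : Steinberg.unitri n F →* Rˣ, Steinberg.charParabolic lam = P →
        Steinberg.IPrime R P =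
          Submodule.span (MonoidAlgebra R (GL (Fin n) F)) {Steinberg.charElt lam} ∧
        Steinberg.LPrime R ℓ P =
          Submodule.span (MonoidAlgebra (Steinberg.Residue R ℓ) (GL (Fin n) F))
            {(Steinberg.ellLattice n F R ℓ).mkQ (Steinberg.charElt lam)}) ∧
    -- the inclusions
    (∀ P Q : Subgroup (GL (Fin n) F),
      Steinberg.IsStandardParabolic P → Steinberg.IsStandardParabolic Q →
      (∃ Q' : Subgroup (GL (Fin n) F), Steinberg.IsStandardParabolic Q' ∧ Q' ≤ P ∧
        Steinberg.ParabolicEquiv Q Q') →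
      Steinberg.IPrime R Q ≤ Steinberg.IPrime R P ∧
        Steinberg.LPrime R ℓ Q ≤ Steinberg.LPrime R ℓ P) ∧
    -- equivalent parabolics
    (∀ P Q : Subgroup (GL (Fin n) F),
      Steinberg.IsStandardParabolic P → Steinberg.IsStandardParabolic Q →
      Steinberg.ParabolicEquiv P Q → Steinberg.IPrime R P = Steinberg.IPrime R Q) := by
  obtain ⟨ψ, hψ⟩ := Steinberg.exists_addChar_ne_one (F := F) p hζ
  have hp : IsUnit (p : R) :=
    Steinberg.isUnit_natCast_of_maximalIdeal_eq Fact.out Fact.out hℓp hmax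
  refine ⟨fun P hP => ⟨⟨_, Steinberg.charParabolic_stdChar hψ hP⟩, fun lam hlam => ?_⟩,
    fun P Q hP hQ ⟨Q', hQ', hle, heq⟩ => ?_, fun P Q hP hQ heq => ?_⟩
  · have h : Steinberg.IPrime R P =
        Submodule.span (MonoidAlgebra R (GL (Fin n) F)) {Steinberg.charElt lam} := by
      rw [Steinberg.IPrime_eq_span_stdChar hψ hP, Steinberg.span_charElt_eq hψ hlam]
    exact ⟨h, Steinberg.LPrime_eq_span h⟩
  · have h := (Steinberg.IPrime_le_of_equiv p hp hψ hQ' hQ heq).trans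
      (Steinberg.IPrime_mono p hp hψ hP hQ' hle)
    exact ⟨h, Steinberg.LPrime_mono h⟩
  · exact le_antisymm (Steinberg.IPrime_le_of_equiv p hp hψ hQ hP heq)
      (Steinberg.IPrime_le_of_equiv p hp hψ hP hQ heq.symm)
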